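/- Let $m,n\ge 0$ be integers, let $x_1,\dots,x_m\ge 0$ and $y_1,\dots,y_n\ge 0$ be real numbers with $x_iy_j<1$ for all $i,j$, and let $t\le 0$. \textbf{Random matrices.} Let $\mathbb P=\{1'<1<2'<2<\cdots\}$ be the alphabet of marked letters $k'$ and unmarked letters $k$, $k\ge1$, and put $|k|=|k'|=k$, $|0|=0$. Let $\mathrm{Prob}_t$ be the distribution of a random $m\times n$ matrix $A=(a_{ij})$ with independent entries in $\mathbb P\cup\{0\}$ such that, for $k\ge 1$, $$\mathrm{Prob}_t(a_{ij}=0)=\tfrac{1-x_iy_j}{1-tx_iy_j},\quad \mathrm{Prob}_t(a_{ij}=k)=\tfrac{1-x_iy_j}{1-tx_iy_j}(x_iy_j)^k,\quad \mathrm{Prob}_t(a_{ij}=k')=\tfrac{1-x_iy_j}{1-tx_iy_j}(-t)(x_iy_j)^k .$$ The biword $w_A$ of $A$ is obtained by reading the entries row by row, from left to right in each row: $a_{ij}$ contributes the pair $\binom ij$ repeated $|a_{ij}|$ times, where the lower entry $j$ of the first of these pairs is marked if $a_{ij}$ is marked. An increasing subsequence of $w_A$ is a weakly increasing subsequence of its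 lower line in which each marked letter $k'$ occurs at most once; $\ell(w_A)$ is the maximal length of such a subsequence. \textbf{The $t$-Schur measure.} Define $e_k(x;t)$ by $\prod_{i=1}^m\frac{1+x_iz}{1+tx_iz}=\sum_{k\ge0}e_k(x;t)z^k$, with $e_k(x;t)=0$ for $k<0$. For a partition $\lambda$ with conjugate $\lambda'$ let $S_\lambda(x;t)=\det\big(e_{\lambda'_i-i+j}(x;t)\big)_{1\le i,j\le\lambda_1}$, and let $s_\lambda(y)$ be the Schur function (the sum of the monomials $y^T$ over the semistandard tableaux $T$ of shape $\lambda$ with entries in $\{1,\dots,n\}$). Put $Z_t=\sum_\lambda S_\lambda(x;t)s_\lambda(y)$, the sum over all partitions, and $\mathrm P_t^{x,y}(\{\lambda\})=\frac1{Z_t}S_\lambda(x;t)s_\lambda(y)$. Define $\mathrm P_t^{y,x}$ in the same way with the roles of $x$ and $y$ exchanged. \textbf{Statement.} $\mathrm{Prob}_t$ is a probability measure; all $S_\lambda(x;t)s_\lambda(y)$ are nonnegative, the series $Z_t$ converges to $\prod_{i,j}\frac{1-tx_iy_j}{1-x_iy_j}$, and $\mathrm P_t^{x,y}$ is a probability measure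 on partitions. For every integer $h\ge0$, $$\mathrm{Prob}_t\big(\ell(w_{A^{\mathsf T}})\le h\big)=\frac1{Z_t}\sum_{\lambda:\,\lambda_1\le h}S_\lambda(x;t)\,s_\lambda(y)=\mathrm P_t^{x,y}(\lambda_1\le h),$$ where $A^{\mathsf T}$ is the transposed matrix (that is, $A$ is read column by column). Equivalently, for the biword of $A$ itself, $$\mathrm{Prob}_t\big(\ell(w_A)\le h\big)=\frac1{Z_t}\sum_{\lambda:\,\lambda_1\le h}S_\lambda(y;t)\,s_\lambda(x)=\mathrm P_t^{y,x}(\lambda_1\le h).$$ -/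

import Mathlib

open MeasureTheory

namespace TSchur

/-- The alphabet `{1' < 1 < 2' < 2 < ⋯}`: `marked k` is `k'` and `unmarked k` is `k`. -/
inductive MarkedLetter : Type
  | marked (k : ℕ+) : MarkedLetter
  | unmarked (k : ℕ+) : MarkedLetter

namespace MarkedLetter

/-- Compare first the underlying integers; at equal integers the marked letter is smaller. -/
def key : MarkedLetter → ℕ+ ×ₗ Bool
  | marked k => toLex (k, false)
  | unmarked k => toLex (k, true)

theorem key_injective : Function.Injective key := by
  intro a b hab
  cases a <;> cases b <;> simp_all [key]

noncomputable instance : LinearOrder MarkedLetter := LinearOrder.lift' key key_injective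

end MarkedLetter

/-- Matrix entries: a letter, or `0`. -/
inductive PEntry : Type
  | zero : PEntry
  | letter (a : MarkedLetter) : PEntry

instance : MeasurableSpace PEntry := ⊤

/-- Matrices of size `m × n` with entries in the marked alphabet together with `0`. -/
abbrev PMatrix (m n : ℕ) : Type := Fin m → Fin n → PEntry

/-- The transposed matrix. -/
def PMatrix.transpose {m n : ℕ} (A : PMatrix m n) : PMatrix n m := fun j i => A i j

/-! ### The biword of a matrix and its increasing subsequences -/

/-- The lower letters contributed by an entry `a` in column `j`: `|a|` copies of `j`, of which the
first one is marked if `a` is marked. -/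
def entryWord (j : ℕ+) : PEntry → List MarkedLetter
  | .zero => []
  | .letter (.unmarked k) => List.replicate (k : ℕ) (.unmarked j)
  | .letter (.marked k) => .marked j :: List.replicate ((k : ℕ) - 1) (.unmarked j)

/-- The biword `w_A`, a list of pairs (upper letter, lower letter); the entries of `A` are read row
by row, and rows and columns are numbered from `1`. -/
def biword {m n : ℕ} (A : PMatrix m n) : List (ℕ+ × MarkedLetter) :=
  (List.finRange m).flatMap fun (i : Fin m) => (List.finRange n).flatMap fun (j : Fin n) =>
    (entryWord (j : ℕ).succPNat (A i j)).map fun a => ((i : ℕ).succPNat, a)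

/-- A weakly increasing word in which each marked letter `k'` occurs at most once. -/
def IsIncreasing (σ : List MarkedLetter) : Prop :=
  σ.Pairwise (· ≤ ·) ∧ ∀ k : ℕ+, ¬ [MarkedLetter.marked k, MarkedLetter.marked k].Sublist σ

/-- `ℓ(w)`: the maximal length of an increasing subsequence of the lower line of `w`. -/
noncomputable def longestIncreasing (w : List (ℕ+ × MarkedLetter)) : ℕ :=
  sSup {k | ∃ σ : List MarkedLetter, σ.Sublist (w.map Prod.snd) ∧ IsIncreasing σ ∧ σ.length = k}

theorem longestIncreasing_isGreatest (w : List (ℕ+ × MarkedLetter)) :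
    IsGreatest {k | ∃ σ : List MarkedLetter,
      σ.Sublist (w.map Prod.snd) ∧ IsIncreasing σ ∧ σ.length = k} (longestIncreasing w) := by
  have hb : BddAbove {k | ∃ σ : List MarkedLetter,
      σ.Sublist (w.map Prod.snd) ∧ IsIncreasing σ ∧ σ.length = k} := by
    refine ⟨(w.map Prod.snd).length, ?_⟩
    rintro k ⟨σ, hσ, -, rfl⟩
    exact hσ.length_le
  exact ⟨Nat.sSup_mem ⟨0, [], List.nil_sublist _, by simp [IsIncreasing], rfl⟩ hb,
    fun k hk => le_csSup hb hk⟩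

/-- `ℓ(A) = ℓ(w_A)`. -/
noncomputable def ell {m n : ℕ} (A : PMatrix m n) : ℕ := longestIncreasing (biword A)

/-! ### The measure on matrices -/

/-- The probability of an entry, for the parameter `q = x_i y_j`. -/
noncomputable def entryProb (t q : ℝ) : PEntry → ℝ
  | .zero => (1 - q) / (1 - t * q)
  | .letter (.unmarked k) => (1 - q) / (1 - t * q) * q ^ (k : ℕ)
  | .letter (.marked k) => (1 - q) / (1 - t * q) * (-t) * q ^ (k : ℕ)

/-- The distribution of one matrix entry. -/
noncomputable def entryMeasure (t q : ℝ) : Measure PEntry :=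
  Measure.sum fun a => ENNReal.ofReal (entryProb t q a) • Measure.dirac a

/-- The distribution of a random `m × n` matrix with independent entries `a_ij`, where `a_ij` has
the parameter `x_i y_j`. -/
noncomputable def matrixMeasure {m n : ℕ} (x : Fin m → ℝ) (y : Fin n → ℝ) (t : ℝ) :
    Measure (PMatrix m n) :=
  Measure.pi fun i => Measure.pi fun j => entryMeasure t (x i * y j)

/-! ### Schur functions and the `t`-Schur measure

Partitions are Young diagrams `μ`, with first part `μ.rowLen 0` and conjugate parts
`μ.colLen 0, μ.colLen 1, …`. -/

/-- The generating series `∏ i, (1 + x_i z) / (1 + t x_i z)`. -/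
noncomputable def genSeries {m : ℕ} (x : Fin m → ℝ) (t : ℝ) : PowerSeries ℝ :=
  ∏ i, (1 + PowerSeries.C (x i) * PowerSeries.X) *
    (1 + PowerSeries.C (t * x i) * PowerSeries.X)⁻¹

/-- The coefficient `e_k(x;t)` of `z ^ k` in the generating series; it is `0` for `k < 0`. -/
noncomputable def e {m : ℕ} (x : Fin m → ℝ) (t : ℝ) (k : ℤ) : ℝ :=
  if 0 ≤ k then PowerSeries.coeff k.toNat (genSeries x t) else 0

/-- The generalized Schur function `S_μ(x;t) = det (e_{μ'_i - i + j}(x;t))`. -/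
noncomputable def genSchur {m : ℕ} (x : Fin m → ℝ) (t : ℝ) (μ : YoungDiagram) : ℝ :=
  Matrix.det (Matrix.of fun i j : Fin (μ.rowLen 0) =>
    e x t ((μ.colLen i : ℤ) - (i : ℤ) + (j : ℤ)))

/-- The variables `y_1, …, y_n` (numbered from `0`) continued by zeros. -/
def extend {n : ℕ} (y : Fin n → ℝ) (k : ℕ) : ℝ := if hk : k < n then y ⟨k, hk⟩ else 0

/-- The Schur function `s_μ(y) = ∑_T y^T`, summed over the semistandard tableaux of shape `μ`. -/
noncomputable def schur {n : ℕ} (y : Fin n → ℝ) (μ : YoungDiagram) : ℝ :=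
  ∑ᶠ T : SemistandardYoungTableau μ, ∏ c ∈ μ.cells, extend y (T c.1 c.2)

/-- Only finitely many tableaux contribute to the Schur function. -/
theorem schur_finite_support {n : ℕ} (y : Fin n → ℝ) (μ : YoungDiagram) :
    (Function.support fun T : SemistandardYoungTableau μ =>
      ∏ c ∈ μ.cells, extend y (T c.1 c.2)).Finite := by
  have hfin : {T : SemistandardYoungTableau μ | ∀ c ∈ μ.cells, T c.1 c.2 < n}.Finite := by
    refine Set.finite_coe_iff.mp (Finite.of_injective
      (fun T => fun c : μ.cells => (⟨T.1 c.1.1 c.1.2, T.2 c.1 c.2⟩ : Fin n)) ?_)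
    intro T T' hTT
    apply Subtype.ext
    ext i j
    by_cases hc : (i, j) ∈ μ
    · have := congrFun hTT ⟨(i, j), hc⟩
      simpa using this
    · rw [T.1.zeros hc, T'.1.zeros hc]
  refine hfin.subset ?_
  intro T hT c hc
  by_contra hcn
  exact hT (Finset.prod_eq_zero hc (by simp [extend, hcn]))

/-- The normalization constant `Z_t = ∑_μ S_μ(x;t) s_μ(y)`. -/
noncomputable def Z {m n : ℕ} (x : Fin m → ℝ) (y : Fin n → ℝ) (t : ℝ) : ℝ :=
  ∑' μ : YoungDiagram, genSchur x t μ * schur y μ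

instance : MeasurableSpace YoungDiagram := ⊤

/-- The `t`-Schur measure `P_t({μ}) = S_μ(x;t) s_μ(y) / Z_t` on partitions. -/
noncomputable def tSchurMeasure {m n : ℕ} (x : Fin m → ℝ) (y : Fin n → ℝ) (t : ℝ) :
    Measure YoungDiagram :=
  Measure.sum fun μ =>
    ENNReal.ofReal (1 / Z x y t * (genSchur x t μ * schur y μ)) • Measure.dirac μ

end TSchur

/-!
The proof runs the Robinson–Schensted–Knuth correspondence as a growth diagram and keeps only the
identities between weighted sums that it yields.

The entry `0`, `k` or `k'` of a matrix is the same as a pair `(b, l)` with `b ≤ 1` marked and `l`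
unmarked letters, and its probability is `(1 - q) / (1 - t q) * (-t q) ^ b * q ^ l` with
`q = x_i y_j`. Read column by column, the matrix therefore gives every column `j` a word that is
weakly increasing in the alphabet `1' < 1 < 2' < 2 < ⋯`. Every point `(letter, j)` of a grid
carries a Young diagram; along a column of the grid the diagrams grow by horizontal strips, and
between neighbouring columns they grow by horizontal strips for an unmarked letter and by vertical
strips for a marked one. In a unit square with corners `λ`, `μ`, `ν` and entry `c`, the opposite
corner `κ` is given by the local rules `hRule` and `vRule`, which push a carry from row to row.
Two facts about the local rules carry the argument.

* For fixed `μ` and `ν` they are bijections `(λ, c) ↦ κ` with `|κ| + |λ| = |μ| + |ν| + c`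
  (`hRule_bijOn`, `vRule_bijOn`), hence they preserve weights (`tsum_hRule`, `tsum_vRule`).
  Composing the squares of the grid (`tsum_step`, `tsum_matrixWeight`) shows that the total weight
  of the matrices whose growth diagram ends in `κ` is a sum over chains of strips in the letters
  times a sum over chains of strips in the columns.
* On first rows they are the recursions `max (μ_1) (ν_1) + c` and `max (ν_1) (μ_1 + c)` of last
  passage percolation, which the longest increasing subsequence obeys as well
  (`IsLongest.append_unmarked`, `IsLongest.append_marked`). So `ℓ` is the first row of the last
  diagram (`ell_transpose_matrixEquiv`).

The two sums over chains are `s_κ(y)` and `S_κ(x;t)`. For `s_κ(y)` the chain records the shapes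
formed by the entries less than `1, 2, …` of a tableau (`restrictBelow_bijOn`). For the determinant
`S_κ(x;t)` a factor `1 + x_i z` of the generating series adds a horizontal strip
(`diagramDet_mul_linear`) and a factor `1 / (1 + t x_i z)` adds a vertical strip
(`diagramDet_div_linear`), by multilinearity in the rows; in particular `S_κ(x;t) ≥ 0`.

All sums are taken in `ℝ≥0∞`, where no convergence has to be discussed. The convergence of `Z_t` and
its value then follow from the fact that the matrices have total probability one, and the statement
about the row reading follows from the one about the column reading by transposition.
-/

namespace TSchur

open scoped ENNReal

/-! ### Young diagrams described by their rows -/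

theorem ext_rowLen {μ ν : YoungDiagram} (h : ∀ i, μ.rowLen i = ν.rowLen i) : μ = ν := by
  ext ⟨i, j⟩
  rw [YoungDiagram.mem_cells, YoungDiagram.mem_cells, YoungDiagram.mem_iff_lt_rowLen,
    YoungDiagram.mem_iff_lt_rowLen, h]

theorem exists_rowLen_eq_zero (μ : YoungDiagram) : ∃ N, ∀ r, N ≤ r → μ.rowLen r = 0 := by
  refine ⟨μ.colLen 0, fun r hr => ?_⟩
  by_contra h
  exact absurd (YoungDiagram.mem_iff_lt_colLen.mp
    (YoungDiagram.mem_iff_lt_rowLen.mpr (Nat.pos_of_ne_zero h))) (by omega)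

theorem rowLen_bot (r : ℕ) : (⊥ : YoungDiagram).rowLen r = 0 := by
  by_contra h
  exact YoungDiagram.notMem_bot _
    (YoungDiagram.mem_iff_lt_rowLen.mpr (Nat.pos_of_ne_zero h) : (r, 0) ∈ (⊥ : YoungDiagram))

/-- The Young diagram whose row lengths are the running minima of `f`. When `f` is weakly
decreasing these are the values of `f`; the length of the first row is `f 0` in any case. -/
def ofRows (f : ℕ → ℕ) (hf : ∃ N, f N = 0) : YoungDiagram where
  cells := (Finset.range (Nat.find hf) ×ˢ Finset.range (f 0)).filter
    fun c => ∀ s ≤ c.1, c.2 < f s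
  isLowerSet := by
    rintro ⟨i, j⟩ ⟨i', j'⟩ ⟨hi, hj⟩ h
    simp only [Finset.coe_filter, Finset.mem_product, Finset.mem_range, Set.mem_ofPred_eq] at *
    exact ⟨⟨by omega, by omega⟩, fun s hs => lt_of_le_of_lt hj (h.2 s (by omega))⟩

theorem mem_ofRows {f : ℕ → ℕ} {hf : ∃ N, f N = 0} {i j : ℕ} :
    (i, j) ∈ ofRows f hf ↔ ∀ s ≤ i, j < f s := by
  rw [← YoungDiagram.mem_cells]
  simp only [ofRows, Finset.mem_filter, Finset.mem_product, Finset.mem_range]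
  refine ⟨fun h => h.2, fun h => ⟨⟨?_, h 0 (Nat.zero_le _)⟩, h⟩⟩
  by_contra hi
  have := h _ (not_lt.mp hi)
  rw [Nat.find_spec hf] at this
  omega

theorem rowLen_zero_ofRows (f : ℕ → ℕ) (hf : ∃ N, f N = 0) : (ofRows f hf).rowLen 0 = f 0 := by
  refine eq_of_forall_lt_iff fun j => ?_
  rw [← YoungDiagram.mem_iff_lt_rowLen, mem_ofRows]
  simp

theorem rowLen_ofRows {f : ℕ → ℕ} (hf : ∃ N, f N = 0) (h : ∀ i, f (i + 1) ≤ f i) (i : ℕ) :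
    (ofRows f hf).rowLen i = f i := by
  refine eq_of_forall_lt_iff fun j => ?_
  rw [← YoungDiagram.mem_iff_lt_rowLen, mem_ofRows]
  exact ⟨fun h => h i le_rfl, fun hj s hs => hj.trans_le (antitone_nat_of_succ_le h hs)⟩

theorem card_eq_sum_rowLen (μ : YoungDiagram) {N : ℕ} (hN : ∀ r, N ≤ r → μ.rowLen r = 0) :
    μ.card = ∑ r ∈ Finset.range N, μ.rowLen r := by
  have h : ∀ c ∈ μ.cells, c.1 ∈ Finset.range N := by
    rintro ⟨i, j⟩ hc
    rw [YoungDiagram.mem_cells, YoungDiagram.mem_iff_lt_rowLen] at hc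
    rw [Finset.mem_range]
    by_contra hi
    rw [hN i (not_lt.mp hi)] at hc
    omega
  rw [YoungDiagram.card, Finset.card_eq_sum_card_fiberwise h]
  refine Finset.sum_congr rfl fun r _ => ?_
  rw [YoungDiagram.rowLen_eq_card]
  rfl

/-! ### Strips and their weights -/

/-- `κ / ν` is a horizontal strip: `κ_1 ≥ ν_1 ≥ κ_2 ≥ ν_2 ≥ ⋯`. -/
def HStrip (ν κ : YoungDiagram) : Prop :=
  ∀ r, ν.rowLen r ≤ κ.rowLen r ∧ κ.rowLen (r + 1) ≤ ν.rowLen r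

/-- `κ / ν` is a vertical strip: every row of `κ` has at most one cell outside `ν`. -/
def VStrip (ν κ : YoungDiagram) : Prop :=
  ∀ r, ν.rowLen r ≤ κ.rowLen r ∧ κ.rowLen r ≤ ν.rowLen r + 1

open Classical in
/-- The weight `a ^ |κ / ν|` of a horizontal strip, and `0` if `κ / ν` is not one. -/
noncomputable def hWeight (a : ℝ≥0∞) (ν κ : YoungDiagram) : ℝ≥0∞ :=
  if HStrip ν κ then a ^ (κ.card - ν.card) else 0

open Classical in
/-- The weight `a ^ |κ / ν|` of a vertical strip, and `0` if `κ / ν` is not one. -/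
noncomputable def vWeight (a : ℝ≥0∞) (ν κ : YoungDiagram) : ℝ≥0∞ :=
  if VStrip ν κ then a ^ (κ.card - ν.card) else 0

theorem card_le_of_rowLen_le {ν κ : YoungDiagram} (h : ∀ r, ν.rowLen r ≤ κ.rowLen r) :
    ν.card ≤ κ.card := by
  refine Finset.card_le_card ?_
  rintro ⟨i, j⟩ hc
  rw [YoungDiagram.mem_cells, YoungDiagram.mem_iff_lt_rowLen] at *
  exact hc.trans_le (h i)

theorem HStrip.card_le {ν κ : YoungDiagram} (h : HStrip ν κ) : ν.card ≤ κ.card :=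
  card_le_of_rowLen_le fun r => (h r).1

theorem VStrip.card_le {ν κ : YoungDiagram} (h : VStrip ν κ) : ν.card ≤ κ.card :=
  card_le_of_rowLen_le fun r => (h r).1

theorem HStrip.bot_iff {μ : YoungDiagram} : HStrip μ ⊥ ↔ μ = ⊥ := by
  constructor
  · intro h
    refine ext_rowLen fun r => ?_
    have := (h r).1
    rw [rowLen_bot] at *
    omega
  · rintro rfl r
    simp [rowLen_bot]

theorem VStrip.bot_iff {μ : YoungDiagram} : VStrip μ ⊥ ↔ μ = ⊥ := by
  constructor
  · intro h
    refine ext_rowLen fun r => ?_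
    have := (h r).1
    rw [rowLen_bot] at *
    omega
  · rintro rfl r
    simp [rowLen_bot]

open Classical in
theorem hWeight_bot (a : ℝ≥0∞) (μ : YoungDiagram) : hWeight a μ ⊥ = if μ = ⊥ then 1 else 0 := by
  rw [hWeight, if_congr HStrip.bot_iff rfl rfl]
  split_ifs with h
  · simp [h]
  · rfl

open Classical in
theorem vWeight_bot (a : ℝ≥0∞) (μ : YoungDiagram) : vWeight a μ ⊥ = if μ = ⊥ then 1 else 0 := by
  rw [vWeight, if_congr VStrip.bot_iff rfl rfl]
  split_ifs with h
  · simp [h]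
  · rfl

/-! ### The local growth rules -/

/-- Reindexing of a sum along a map that is bijective between sets carrying the two summands. -/
theorem tsum_eq_tsum_of_bijOn {α β : Type*} {f : α → ℝ≥0∞} {F : β → ℝ≥0∞} {S : Set α} {T : Set β}
    (K : α → β) (hK : Set.BijOn K S T) (hf : ∀ a, a ∉ S → f a = 0) (hF : ∀ b, b ∉ T → F b = 0)
    (h : ∀ a ∈ S, f a = F (K a)) : ∑' a, f a = ∑' b, F b := by
  rw [← tsum_subtype_eq_of_support_subset (f := f) (s := S)
      (fun a ha => by by_contra hS; exact ha (hf a hS)),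
    ← tsum_subtype_eq_of_support_subset (f := F) (s := T)
      (fun b hb => by by_contra hT; exact hb (hF b hT)),
    ← (Equiv.ofBijective _ hK.bijective).tsum_eq]
  exact tsum_congr fun a => h a a.2

/-- The carries of the local rule for horizontal strips: the carry `c` enters the first row and
the carry `min (μ_r) (ν_r) - λ_r` leaves row `r` for the next one. -/
def hCarry (lam mu nu : ℕ → ℕ) (c : ℕ) : ℕ → ℕ
  | 0 => c
  | r + 1 => min (mu r) (nu r) - lam r

theorem hRule_aux (lam μ ν : YoungDiagram) (c : ℕ) :
    ∃ N, max (μ.rowLen N) (ν.rowLen N) + hCarry lam.rowLen μ.rowLen ν.rowLen c N = 0 := by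
  obtain ⟨M, hM⟩ := exists_rowLen_eq_zero μ
  obtain ⟨N, hN⟩ := exists_rowLen_eq_zero ν
  refine ⟨M + N + 1, ?_⟩
  rw [hCarry, hM _ (by omega), hM _ (by omega), hN _ (by omega)]
  simp

/-- The local rule for an unmarked letter: the diagram `κ` opposite to `λ` in a square of the
growth diagram with the other corners `μ`, `ν` and the entry `c`. -/
def hRule (lam μ ν : YoungDiagram) (c : ℕ) : YoungDiagram :=
  ofRows _ (hRule_aux lam μ ν c)

theorem rowLen_zero_hRule (lam μ ν : YoungDiagram) (c : ℕ) :
    (hRule lam μ ν c).rowLen 0 = max (μ.rowLen 0) (ν.rowLen 0) + c :=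
  rowLen_zero_ofRows _ _

theorem rowLen_hRule {lam μ ν : YoungDiagram} {c : ℕ} (h1 : HStrip lam ν) (h2 : HStrip lam μ)
    (r : ℕ) : (hRule lam μ ν c).rowLen r =
      max (μ.rowLen r) (ν.rowLen r) + hCarry lam.rowLen μ.rowLen ν.rowLen c r := by
  refine rowLen_ofRows (hRule_aux lam μ ν c) (fun r => ?_) r
  have h1r := h1 r
  have h2r := h2 r
  simp only [hCarry]
  omega

/-- The sizes of the corners: the carries telescope over the rows. -/
theorem hRule_card {lam μ ν : YoungDiagram} {c : ℕ} (h1 : HStrip lam ν) (h2 : HStrip lam μ) :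
    (hRule lam μ ν c).card + lam.card = μ.card + ν.card + c := by
  obtain ⟨N₁, hN₁⟩ := exists_rowLen_eq_zero μ
  obtain ⟨N₂, hN₂⟩ := exists_rowLen_eq_zero ν
  obtain ⟨N₃, hN₃⟩ := exists_rowLen_eq_zero lam
  obtain ⟨N₄, hN₄⟩ := exists_rowLen_eq_zero (hRule lam μ ν c)
  have key : ∀ n, ∑ r ∈ Finset.range n, (hRule lam μ ν c).rowLen r +
      ∑ r ∈ Finset.range n, lam.rowLen r + hCarry lam.rowLen μ.rowLen ν.rowLen c n =
      ∑ r ∈ Finset.range n, μ.rowLen r + ∑ r ∈ Finset.range n, ν.rowLen r + c := by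
    intro n
    induction n with
    | zero => simp [hCarry]
    | succ n ih =>
      simp only [Finset.sum_range_succ]
      have := h1 n
      have := h2 n
      have h3 := rowLen_hRule (c := c) h1 h2 n
      have h4 : hCarry lam.rowLen μ.rowLen ν.rowLen c (n + 1) =
        min (μ.rowLen n) (ν.rowLen n) - lam.rowLen n := rfl
      omega
  have hc : hCarry lam.rowLen μ.rowLen ν.rowLen c (N₁ + N₂ + N₃ + N₄ + 1) = 0 := by
    rw [hCarry, hN₁ _ (by omega)]
    simp
  rw [card_eq_sum_rowLen μ (N := N₁ + N₂ + N₃ + N₄ + 1) fun r hr => hN₁ r (by omega),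
    card_eq_sum_rowLen ν (N := N₁ + N₂ + N₃ + N₄ + 1) fun r hr => hN₂ r (by omega),
    card_eq_sum_rowLen lam (N := N₁ + N₂ + N₃ + N₄ + 1) fun r hr => hN₃ r (by omega),
    card_eq_sum_rowLen (hRule lam μ ν c) (N := N₁ + N₂ + N₃ + N₄ + 1) fun r hr => hN₄ r (by omega),
    ← key, hc, add_zero]

theorem hRule_bijOn (μ ν : YoungDiagram) :
    Set.BijOn (fun p : YoungDiagram × ℕ => hRule p.1 μ ν p.2)
      {p | HStrip p.1 ν ∧ HStrip p.1 μ} {κ | HStrip ν κ ∧ HStrip μ κ} := by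
  refine ⟨?_, ?_, ?_⟩
  · rintro ⟨lam, c⟩ ⟨h1, h2⟩
    dsimp only at h1 h2 ⊢
    constructor
    all_goals
      intro r
      have h1r := h1 r
      have h2r := h2 r
      rw [rowLen_hRule h1 h2, rowLen_hRule h1 h2]
      simp only [hCarry]
      omega
  · rintro ⟨lam, c⟩ ⟨h1, h2⟩ ⟨lam', c'⟩ ⟨h1', h2'⟩ h
    have hr : ∀ r, hCarry lam.rowLen μ.rowLen ν.rowLen c r =
        hCarry lam'.rowLen μ.rowLen ν.rowLen c' r := by
      intro r
      have := congrArg (fun κ => YoungDiagram.rowLen κ r) h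
      simp only [rowLen_hRule h1 h2, rowLen_hRule h1' h2'] at this
      omega
    have hl : lam = lam' := by
      refine ext_rowLen fun r => ?_
      have := hr (r + 1)
      have a1 := h1 r
      have a2 := h2 r
      have a3 := h1' r
      have a4 := h2' r
      simp only [hCarry] at this
      simp only at a1 a2 a3 a4
      omega
    have hc : c = c' := hr 0
    rw [hl, hc]
  · rintro κ ⟨h1, h2⟩
    -- the row lengths of `λ`, read off from `κ`
    let f : ℕ → ℕ := fun r => min (μ.rowLen r) (ν.rowLen r) -
      (κ.rowLen (r + 1) - max (μ.rowLen (r + 1)) (ν.rowLen (r + 1)))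
    have hf0 : ∃ N, f N = 0 := by
      obtain ⟨N, hN⟩ := exists_rowLen_eq_zero μ
      exact ⟨N, by simp [f, hN N le_rfl]⟩
    have hf : ∀ r, (ofRows f hf0).rowLen r = f r := by
      refine rowLen_ofRows hf0 fun r => ?_
      have a1 := h1 r
      have a2 := h2 r
      have a3 := h1 (r + 1)
      have a4 := h2 (r + 1)
      simp only [f]
      omega
    have hs1 : HStrip (ofRows f hf0) ν := by
      intro r
      have a1 := h1 r
      have a2 := h2 r
      have a3 := h1 (r + 1)
      have a4 := h2 (r + 1)
      rw [hf]
      simp only [f]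
      omega
    have hs2 : HStrip (ofRows f hf0) μ := by
      intro r
      have a1 := h1 r
      have a2 := h2 r
      have a3 := h1 (r + 1)
      have a4 := h2 (r + 1)
      rw [hf]
      simp only [f]
      omega
    refine ⟨(ofRows f hf0, κ.rowLen 0 - max (μ.rowLen 0) (ν.rowLen 0)), ⟨hs1, hs2⟩, ?_⟩
    refine ext_rowLen fun r => ?_
    simp only
    rw [rowLen_hRule hs1 hs2]
    cases r with
    | zero =>
      have a1 := h1 0
      have a2 := h2 0
      simp only [hCarry]
      omega
    | succ r =>
      have a1 := h1 r
      have a2 := h2 r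
      have a3 := h1 (r + 1)
      have a4 := h2 (r + 1)
      simp only [hCarry, hf]
      simp only [f]
      omega

/-- The local rule for an unmarked letter preserves weights, whence a skew Cauchy identity which
also keeps track of the new corner. -/
theorem tsum_hRule (a b : ℝ≥0∞) (μ ν : YoungDiagram) (g : YoungDiagram → ℝ≥0∞) :
    ∑' p : YoungDiagram × ℕ,
        hWeight a p.1 ν * hWeight b p.1 μ * (a * b) ^ p.2 * g (hRule p.1 μ ν p.2) =
      ∑' κ, hWeight b ν κ * hWeight a μ κ * g κ := by
  refine tsum_eq_tsum_of_bijOn _ (hRule_bijOn μ ν) ?_ ?_ ?_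
  · rintro ⟨lam, c⟩ hp
    by_cases h1 : HStrip lam ν
    · have h2 : ¬ HStrip lam μ := fun h2 => hp ⟨h1, h2⟩
      simp [hWeight, h2]
    · simp [hWeight, h1]
  · intro κ hκ
    by_cases h1 : HStrip ν κ
    · have h2 : ¬ HStrip μ κ := fun h2 => hκ ⟨h1, h2⟩
      simp [hWeight, h2]
    · simp [hWeight, h1]
  · rintro ⟨lam, c⟩ ⟨h1, h2⟩
    obtain ⟨h3, h4⟩ := (hRule_bijOn μ ν).mapsTo (show (lam, c) ∈ _ from ⟨h1, h2⟩)
    have hcard := hRule_card (c := c) h1 h2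
    have a1 := h1.card_le
    have a2 := h2.card_le
    have e1 : (hRule lam μ ν c).card - ν.card = (μ.card - lam.card) + c := by
      simp only at *; omega
    have e2 : (hRule lam μ ν c).card - μ.card = (ν.card - lam.card) + c := by
      simp only at *; omega
    simp only [hWeight] at *
    rw [if_pos h1, if_pos h2, if_pos h3, if_pos h4, e1, e2, pow_add, pow_add, mul_pow]
    ring

/-- The carries of the local rule for a marked letter. In contrast to `hCarry`, the carry leaving a
row depends on the carry entering it. -/
def vCarry (lam mu nu : ℕ → ℕ) (c : ℕ) : ℕ → ℕ
  | 0 => c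
  | r + 1 => min (nu r) (mu r + vCarry lam mu nu c r) - lam r

theorem vCarry_eq_zero {lam mu nu : ℕ → ℕ} {c r : ℕ} (h : nu r = 0) :
    vCarry lam mu nu c (r + 1) = 0 := by
  simp [vCarry, h]

theorem vRule_aux (lam μ ν : YoungDiagram) (c : ℕ) :
    ∃ N, max (ν.rowLen N) (μ.rowLen N + vCarry lam.rowLen μ.rowLen ν.rowLen c N) = 0 := by
  obtain ⟨M, hM⟩ := exists_rowLen_eq_zero μ
  obtain ⟨N, hN⟩ := exists_rowLen_eq_zero ν
  refine ⟨M + N + 1, ?_⟩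
  rw [vCarry_eq_zero (hN _ (by omega)), hM _ (by omega), hN _ (by omega)]
  simp

/-- The local rule for a marked letter, where `ν / λ` and `κ / μ` are vertical strips. -/
def vRule (lam μ ν : YoungDiagram) (c : ℕ) : YoungDiagram :=
  ofRows _ (vRule_aux lam μ ν c)

theorem rowLen_zero_vRule (lam μ ν : YoungDiagram) (c : ℕ) :
    (vRule lam μ ν c).rowLen 0 = max (ν.rowLen 0) (μ.rowLen 0 + c) :=
  rowLen_zero_ofRows _ _

theorem vCarry_succ_le {lam ν : YoungDiagram} (mu : ℕ → ℕ) (c : ℕ) (h1 : VStrip lam ν) (r : ℕ) :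
    vCarry lam.rowLen mu ν.rowLen c (r + 1) ≤ 1 := by
  have h1r := h1 r
  simp only [vCarry]
  omega

theorem vCarry_le {lam ν : YoungDiagram} (mu : ℕ → ℕ) {c : ℕ} (h1 : VStrip lam ν) (hc : c ≤ 1)
    (r : ℕ) : vCarry lam.rowLen mu ν.rowLen c r ≤ 1 := by
  cases r with
  | zero => exact hc
  | succ r => exact vCarry_succ_le mu c h1 r

theorem rowLen_vRule {lam μ ν : YoungDiagram} {c : ℕ} (h1 : VStrip lam ν) (h2 : HStrip lam μ)
    (r : ℕ) : (vRule lam μ ν c).rowLen r =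
      max (ν.rowLen r) (μ.rowLen r + vCarry lam.rowLen μ.rowLen ν.rowLen c r) := by
  refine rowLen_ofRows (vRule_aux lam μ ν c) (fun r => ?_) r
  have h1r := h1 r
  have h2r := h2 r
  have h3 := ν.rowLen_anti r (r + 1) (by omega)
  simp only [vCarry]
  omega

theorem vRule_card {lam μ ν : YoungDiagram} {c : ℕ} (h1 : VStrip lam ν) (h2 : HStrip lam μ) :
    (vRule lam μ ν c).card + lam.card = μ.card + ν.card + c := by
  obtain ⟨N₁, hN₁⟩ := exists_rowLen_eq_zero μ
  obtain ⟨N₂, hN₂⟩ := exists_rowLen_eq_zero ν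
  obtain ⟨N₃, hN₃⟩ := exists_rowLen_eq_zero lam
  obtain ⟨N₄, hN₄⟩ := exists_rowLen_eq_zero (vRule lam μ ν c)
  have key : ∀ n, ∑ r ∈ Finset.range n, (vRule lam μ ν c).rowLen r +
      ∑ r ∈ Finset.range n, lam.rowLen r + vCarry lam.rowLen μ.rowLen ν.rowLen c n =
      ∑ r ∈ Finset.range n, μ.rowLen r + ∑ r ∈ Finset.range n, ν.rowLen r + c := by
    intro n
    induction n with
    | zero => simp [vCarry]
    | succ n ih =>
      simp only [Finset.sum_range_succ]
      have := h1 n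
      have := h2 n
      have h3 := rowLen_vRule (c := c) h1 h2 n
      have h4 : vCarry lam.rowLen μ.rowLen ν.rowLen c (n + 1) =
        min (ν.rowLen n) (μ.rowLen n + vCarry lam.rowLen μ.rowLen ν.rowLen c n) - lam.rowLen n :=
        rfl
      omega
  have hc : vCarry lam.rowLen μ.rowLen ν.rowLen c (N₁ + N₂ + N₃ + N₄ + 1) = 0 :=
    vCarry_eq_zero (hN₂ _ (by omega))
  rw [card_eq_sum_rowLen μ (N := N₁ + N₂ + N₃ + N₄ + 1) fun r hr => hN₁ r (by omega),
    card_eq_sum_rowLen ν (N := N₁ + N₂ + N₃ + N₄ + 1) fun r hr => hN₂ r (by omega),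
    card_eq_sum_rowLen lam (N := N₁ + N₂ + N₃ + N₄ + 1) fun r hr => hN₃ r (by omega),
    card_eq_sum_rowLen (vRule lam μ ν c) (N := N₁ + N₂ + N₃ + N₄ + 1) fun r hr => hN₄ r (by omega),
    ← key, hc, add_zero]

/-- The carries can be recovered from the last row upwards. -/
theorem vCarry_eq_ite {lam μ ν : YoungDiagram} {c : ℕ} (hc : c ≤ 1) (h1 : VStrip lam ν)
    (h2 : HStrip lam μ) (r : ℕ) :
    vCarry lam.rowLen μ.rowLen ν.rowLen c r =
      if ν.rowLen r = μ.rowLen r + 1 then vCarry lam.rowLen μ.rowLen ν.rowLen c (r + 1)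
      else (vRule lam μ ν c).rowLen r - μ.rowLen r := by
  have h1r := h1 r
  have h2r := h2 r
  have h3 := vCarry_le μ.rowLen h1 hc r
  rw [rowLen_vRule h1 h2]
  split_ifs with h
  · simp only [vCarry]
    omega
  · omega

/-- A sequence vanishing from `N` on is determined by a downward recursion. -/
theorem exists_downward_rec (N : ℕ) (F : ℕ → ℕ → ℕ) :
    ∃ d : ℕ → ℕ, (∀ r, N ≤ r → d r = 0) ∧ ∀ r, r < N → d r = F r (d (r + 1)) := by
  let D : ℕ → ℕ := fun k => Nat.rec 0 (fun k x => F (N - (k + 1)) x) k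
  refine ⟨fun r => D (N - r), fun r hr => ?_, fun r hr => ?_⟩
  · simp [D, Nat.sub_eq_zero_of_le hr]
  · have h1 : N - r = (N - (r + 1)) + 1 := by omega
    simp only [h1]
    change F (N - (N - (r + 1) + 1)) (D (N - (r + 1))) = _
    rw [show N - (N - (r + 1) + 1) = r by omega]

theorem vRule_bijOn (μ ν : YoungDiagram) :
    Set.BijOn (fun p : YoungDiagram × ℕ => vRule p.1 μ ν p.2)
      {p | VStrip p.1 ν ∧ HStrip p.1 μ ∧ p.2 ≤ 1} {κ | HStrip ν κ ∧ VStrip μ κ} := by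
  refine ⟨?_, ?_, ?_⟩
  · rintro ⟨lam, c⟩ ⟨h1, h2, hc⟩
    dsimp only at h1 h2 hc ⊢
    constructor
    · intro r
      have h1r := h1 r
      have h2r := h2 r
      rw [rowLen_vRule h1 h2, rowLen_vRule h1 h2]
      have h3 := ν.rowLen_anti r (r + 1) (by omega)
      simp only [vCarry]
      omega
    · intro r
      have h1r := h1 r
      have h2r := h2 r
      have h3 := vCarry_le μ.rowLen h1 hc r
      rw [rowLen_vRule h1 h2]
      omega
  · rintro ⟨lam, c⟩ ⟨h1, h2, hc⟩ ⟨lam', c'⟩ ⟨h1', h2', hc'⟩ h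
    simp only at h1 h2 hc h1' h2' hc' h
    obtain ⟨N, hN⟩ := exists_rowLen_eq_zero ν
    have hr : ∀ k r, N + 1 ≤ r + k → vCarry lam.rowLen μ.rowLen ν.rowLen c r =
        vCarry lam'.rowLen μ.rowLen ν.rowLen c' r := by
      intro k
      induction k with
      | zero =>
        intro r hr
        obtain ⟨s, rfl⟩ : ∃ s, r = s + 1 := ⟨r - 1, by omega⟩
        rw [vCarry_eq_zero (hN _ (by omega)), vCarry_eq_zero (hN _ (by omega))]
      | succ k ih =>
        intro r hr
        rw [vCarry_eq_ite hc h1 h2, vCarry_eq_ite hc' h1' h2', h, ih (r + 1) (by omega)]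
    have hl : lam = lam' := by
      refine ext_rowLen fun r => ?_
      have e0 := hr (N + 1) r (by omega)
      have e1 := hr (N + 1) (r + 1) (by omega)
      have a1 := h1 r
      have a2 := h2 r
      have a3 := h1' r
      have a4 := h2' r
      simp only [vCarry] at e1
      omega
    have hc : c = c' := hr (N + 1) 0 (by omega)
    rw [hl, hc]
  · rintro κ ⟨h1, h2⟩
    obtain ⟨N, hN⟩ := exists_rowLen_eq_zero κ
    -- the carries `d`, reconstructed from the last row upwards as in `vCarry_eq_ite`
    obtain ⟨d, hd0, hd⟩ := exists_downward_rec N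
      fun r x => if ν.rowLen r = μ.rowLen r + 1 then x else κ.rowLen r - μ.rowLen r
    have hd' : ∀ r, d r =
        if ν.rowLen r = μ.rowLen r + 1 then d (r + 1) else κ.rowLen r - μ.rowLen r := by
      intro r
      by_cases hr : r < N
      · exact hd r hr
      · have hκ := hN r (not_lt.mp hr)
        rw [hd0 r (not_lt.mp hr), hd0 (r + 1) (by omega), hκ]
        simp
    have hd1 : ∀ k r, N ≤ r + k → d r ≤ 1 ∧ (1 ≤ d r → κ.rowLen r = μ.rowLen r + 1) := by
      intro k
      induction k with
      | zero =>
        intro r hr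
        rw [hd0 r hr]
        omega
      | succ k ih =>
        intro r hr
        have a1 := h1 r
        have a2 := h2 r
        have a3 := ih (r + 1) (by omega)
        rw [hd' r]
        split_ifs <;> omega
    replace hd1 : ∀ r, d r ≤ 1 ∧ (1 ≤ d r → κ.rowLen r = μ.rowLen r + 1) :=
      fun r => hd1 N r (by omega)
    -- the row lengths of `λ`
    let f : ℕ → ℕ := fun r => min (ν.rowLen r) (μ.rowLen r + d r) - d (r + 1)
    have hfμ : ∀ r, f r ≤ μ.rowLen r ∧ μ.rowLen (r + 1) ≤ f r ∧ f r ≤ ν.rowLen r ∧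
        ν.rowLen r ≤ f r + 1 ∧ d (r + 1) + f r = min (ν.rowLen r) (μ.rowLen r + d r) := by
      intro r
      have a1 := h1 r
      have a2 := h2 r
      have a3 := hd1 r
      have a4 := hd1 (r + 1)
      have a5 := h2 (r + 1)
      have a6 := μ.rowLen_anti r (r + 1) (by omega)
      have a7 := hd' r
      simp only [f]
      split_ifs at a7 <;> omega
    have hf0 : ∃ N, f N = 0 := by
      obtain ⟨N, hN⟩ := exists_rowLen_eq_zero ν
      exact ⟨N, by simp [f, hN N le_rfl]⟩
    have hf : ∀ r, (ofRows f hf0).rowLen r = f r :=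
      rowLen_ofRows hf0 fun r => (hfμ (r + 1)).1.trans (hfμ r).2.1
    have hs1 : VStrip (ofRows f hf0) ν := fun r => by
      rw [hf]; exact ⟨(hfμ r).2.2.1, (hfμ r).2.2.2.1⟩
    have hs2 : HStrip (ofRows f hf0) μ := fun r => by
      rw [hf]; exact ⟨(hfμ r).1, (hfμ r).2.1⟩
    have hcar : ∀ r, vCarry (ofRows f hf0).rowLen μ.rowLen ν.rowLen (d 0) r = d r := by
      intro r
      induction r with
      | zero => rfl
      | succ r ih =>
        have := hfμ r
        simp only [vCarry, ih, hf]
        omega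
    refine ⟨(ofRows f hf0, d 0), ⟨hs1, hs2, (hd1 0).1⟩, ?_⟩
    refine ext_rowLen fun r => ?_
    simp only
    rw [rowLen_vRule hs1 hs2, hcar]
    have a1 := h1 r
    have a2 := h2 r
    have a3 := hd1 r
    have a7 := hd' r
    split_ifs at a7 <;> omega

/-- The local rule for a marked letter preserves weights, whence a dual skew Cauchy identity which
also keeps track of the new corner. -/
theorem tsum_vRule (a b : ℝ≥0∞) (μ ν : YoungDiagram) (g : YoungDiagram → ℝ≥0∞) :
    ∑' p : YoungDiagram × Bool,
        vWeight a p.1 ν * hWeight b p.1 μ * (a * b) ^ p.2.toNat * g (vRule p.1 μ ν p.2.toNat) =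
      ∑' κ, hWeight b ν κ * vWeight a μ κ * g κ := by
  have hbij : Set.BijOn (fun p : YoungDiagram × Bool => vRule p.1 μ ν p.2.toNat)
      {p | VStrip p.1 ν ∧ HStrip p.1 μ} {κ | HStrip ν κ ∧ VStrip μ κ} := by
    refine (vRule_bijOn μ ν).comp (g := fun p : YoungDiagram × ℕ => vRule p.1 μ ν p.2)
      (f := fun p : YoungDiagram × Bool => (p.1, p.2.toNat)) ⟨?_, ?_, ?_⟩
    · rintro ⟨lam, c⟩ ⟨h1, h2⟩
      exact ⟨h1, h2, c.toNat_le⟩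
    · rintro ⟨lam, c⟩ - ⟨lam', c'⟩ - h
      simp only [Prod.mk.injEq] at h ⊢
      exact ⟨h.1, by cases c <;> cases c' <;> simp_all⟩
    · rintro ⟨lam, c⟩ ⟨h1, h2, hc⟩
      simp only at hc
      refine ⟨(lam, decide (c = 1)), ⟨h1, h2⟩, ?_⟩
      interval_cases c <;> rfl
  refine tsum_eq_tsum_of_bijOn _ hbij ?_ ?_ ?_
  · rintro ⟨lam, c⟩ hp
    by_cases h1 : VStrip lam ν
    · have h2 : ¬ HStrip lam μ := fun h2 => hp ⟨h1, h2⟩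
      simp [hWeight, h2]
    · simp [vWeight, h1]
  · intro κ hκ
    by_cases h1 : HStrip ν κ
    · have h2 : ¬ VStrip μ κ := fun h2 => hκ ⟨h1, h2⟩
      simp [vWeight, h2]
    · simp [hWeight, h1]
  · rintro ⟨lam, c⟩ ⟨h1, h2⟩
    obtain ⟨h3, h4⟩ := hbij.mapsTo (show (lam, c) ∈ _ from ⟨h1, h2⟩)
    have hcard := vRule_card (c := c.toNat) h1 h2
    have a1 := h1.card_le
    have a2 := h2.card_le
    have e1 : (vRule lam μ ν c.toNat).card - ν.card = (μ.card - lam.card) + c.toNat := by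
      simp only at *; omega
    have e2 : (vRule lam μ ν c.toNat).card - μ.card = (ν.card - lam.card) + c.toNat := by
      simp only at *; omega
    simp only [hWeight, vWeight] at *
    rw [if_pos h1, if_pos h2, if_pos h3, if_pos h4, e1, e2, pow_add, pow_add, mul_pow]
    ring

/-! ### Columns of the growth diagram -/

/-- The last diagram of a column of the growth diagram. Every column starts with an empty diagram
that is not recorded, so this is `⊥` for a column without recorded diagrams. -/
def top : {n : ℕ} → (Fin n → YoungDiagram) → YoungDiagram
  | 0, _ => ⊥
  | n + 1, lam => lam (Fin.last n)

theorem top_succ {n : ℕ} (lam : Fin (n + 1) → YoungDiagram) : top lam = lam (Fin.last n) := rfl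

/-- The column obtained from the column `lam` by applying the local rule `K` with the entries
`c`. -/
def step {ι : Type*} (K : YoungDiagram → YoungDiagram → YoungDiagram → ι → YoungDiagram) :
    {n : ℕ} → (Fin n → YoungDiagram) → (Fin n → ι) → Fin n → YoungDiagram
  | 0, _, _ => Fin.elim0
  | n + 1, lam, c =>
    Fin.snoc (α := fun _ => YoungDiagram) (step K (Fin.init lam) (Fin.init c))
      (K (top (Fin.init lam)) (lam (Fin.last n)) (top (step K (Fin.init lam) (Fin.init c)))
        (c (Fin.last n)))

/-- The weight of a column: the monomial of the tableau that it encodes, and `0` if the column is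
not a chain of horizontal strips. -/
noncomputable def chainWeight : {n : ℕ} → (Fin n → ℝ≥0∞) → (Fin n → YoungDiagram) → ℝ≥0∞
  | 0, _, _ => 1
  | n + 1, y, lam =>
    chainWeight (Fin.init y) (Fin.init lam) *
      hWeight (y (Fin.last n)) (top (Fin.init lam)) (lam (Fin.last n))

theorem tsum_fin_succ {n : ℕ} {α : Type*} (F : (Fin (n + 1) → α) → ℝ≥0∞) :
    ∑' f, F f = ∑' (f : Fin n → α) (a : α), F (Fin.snoc (α := fun _ => α) f a) := by
  rw [← (Fin.snocEquiv fun _ => α).tsum_eq, ENNReal.tsum_prod', ENNReal.tsum_comm]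
  rfl

/-- A local rule that satisfies a skew Cauchy identity gives an identity between the weights of a
column and of the next one. The function `H` sees the whole new column and the last diagram of the
old one; this is the generality that an induction over the length of the column needs. -/
theorem tsum_step {ι : Type*} {w : YoungDiagram → YoungDiagram → ℝ≥0∞} {v : ℝ≥0∞ → ι → ℝ≥0∞}
    {K : YoungDiagram → YoungDiagram → YoungDiagram → ι → YoungDiagram}
    (hbot : ∀ μ, w μ ⊥ = open Classical in if μ = ⊥ then 1 else 0)
    (hloc : ∀ b μ ν (g : YoungDiagram → ℝ≥0∞),
      ∑' p : YoungDiagram × ι, w p.1 ν * hWeight b p.1 μ * v b p.2 * g (K p.1 μ ν p.2) =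
        ∑' κ, hWeight b ν κ * w μ κ * g κ)
    {n : ℕ} (y : Fin n → ℝ≥0∞) (H : YoungDiagram → (Fin n → YoungDiagram) → ℝ≥0∞) :
    ∑' (lam : Fin n → YoungDiagram) (c : Fin n → ι),
        chainWeight y lam * (∏ j, v (y j) (c j)) * H (top lam) (step K lam c) =
      ∑' kap : Fin n → YoungDiagram, chainWeight y kap * ∑' μ, w μ (top kap) * H μ kap := by
  induction n with
  | zero =>
    have h0 : ∀ f : Fin 0 → YoungDiagram, f = Fin.elim0 := fun f => Subsingleton.elim _ _
    rw [tsum_eq_single Fin.elim0 fun f hf => (hf (h0 f)).elim,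
      tsum_eq_single (fun i => i.elim0) fun f hf => (hf (Subsingleton.elim _ _)).elim,
      tsum_eq_single Fin.elim0 fun f hf => (hf (h0 f)).elim]
    simp only [chainWeight, top, hbot, step]
    rw [tsum_eq_single ⊥ fun μ hμ => by simp [hμ]]
    simp
  | succ n ih =>
    -- sum over the last diagram of the old column and over the last entry first
    let H' : YoungDiagram → (Fin n → YoungDiagram) → ℝ≥0∞ := fun lam kap =>
      ∑' (μ : YoungDiagram) (c : ι), hWeight (y (Fin.last n)) lam μ * v (y (Fin.last n)) c *
        H μ (Fin.snoc (α := fun _ => YoungDiagram) kap (K lam μ (top kap) c))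
    have e1 : ∑' (lam : Fin (n + 1) → YoungDiagram) (c : Fin (n + 1) → ι),
        chainWeight y lam * (∏ j, v (y j) (c j)) * H (top lam) (step K lam c) =
        ∑' (lam : Fin n → YoungDiagram) (c : Fin n → ι),
          chainWeight (Fin.init y) lam * (∏ j, v (Fin.init (α := fun _ => ℝ≥0∞) y j) (c j)) *
            H' (top lam) (step K lam c) := by
      rw [tsum_fin_succ]
      refine tsum_congr fun lam => ?_
      simp_rw [tsum_fin_succ (α := ι)]
      rw [ENNReal.tsum_comm]
      refine tsum_congr fun c => ?_
      simp only [H', ← ENNReal.tsum_mul_left]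
      refine tsum_congr fun μ => tsum_congr fun a => ?_
      simp only [chainWeight, top_succ, step, Fin.init_snoc, Fin.snoc_last, Fin.prod_univ_castSucc,
        Fin.snoc_castSucc, Fin.init]
      ring
    rw [e1, ih, tsum_fin_succ]
    refine tsum_congr fun kap => ?_
    simp only [chainWeight, Fin.init_snoc, Fin.snoc_last, top_succ]
    simp only [mul_assoc]
    rw [ENNReal.tsum_mul_left]
    congr 1
    simp only [H', ← ENNReal.tsum_mul_left]
    rw [ENNReal.tsum_comm]
    conv_rhs => rw [ENNReal.tsum_comm]
    refine tsum_congr fun μ => ?_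
    rw [← ENNReal.tsum_prod (f := fun lam c => w lam (top kap) *
      (hWeight (y (Fin.last n)) lam μ * v (y (Fin.last n)) c *
        H μ (Fin.snoc (α := fun _ => YoungDiagram) kap (K lam μ (top kap) c))))]
    simp only [← mul_assoc]
    rw [hloc _ _ _ fun κ => H μ (Fin.snoc (α := fun _ => YoungDiagram) kap κ)]

/-! ### The whole growth diagram -/

/-- The last column of the growth diagram of a matrix: the column belonging to a row `i` of the
matrix arises from the preceding one by a step for the marked letter, followed by a step for the
unmarked one. The entry `(b, k)` stands for `b` marked and `k` unmarked letters. -/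
def lastColumn {n : ℕ} : {m : ℕ} → (Fin m → Fin n → Bool × ℕ) → Fin n → YoungDiagram
  | 0, _ => fun _ => ⊥
  | m + 1, A =>
    step hRule (step (fun lam μ ν b => vRule lam μ ν (Bool.toNat b)) (lastColumn (Fin.init A))
      fun j => (A (Fin.last m) j).1) fun j => (A (Fin.last m) j).2

open Classical in
/-- The sum of the weights of all chains from `⊥` to a diagram in which vertical and horizontal
strips alternate, with weights `u i` and `x i` for the cells. -/
noncomputable def superSchur : {m : ℕ} → (Fin m → ℝ≥0∞) → (Fin m → ℝ≥0∞) → YoungDiagram → ℝ≥0∞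
  | 0, _, _, κ => if κ = ⊥ then 1 else 0
  | m + 1, u, x, κ =>
    ∑' ν, hWeight (x (Fin.last m)) ν κ *
      ∑' μ, vWeight (u (Fin.last m)) μ ν * superSchur (Fin.init u) (Fin.init x) μ

/-- The weight of a matrix. -/
noncomputable def matrixWeight {m n : ℕ} (u x : Fin m → ℝ≥0∞) (y : Fin n → ℝ≥0∞)
    (A : Fin m → Fin n → Bool × ℕ) : ℝ≥0∞ :=
  ∏ i, ∏ j, ((u i * y j) ^ (A i j).1.toNat * (x i * y j) ^ (A i j).2)

theorem chainWeight_bot {n : ℕ} (y : Fin n → ℝ≥0∞) : chainWeight y (fun _ => ⊥) = 1 := by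
  induction n with
  | zero => rfl
  | succ n ih =>
    have h1 : Fin.init (fun _ : Fin (n + 1) => (⊥ : YoungDiagram)) = fun _ => ⊥ := rfl
    have h2 : top (fun _ : Fin n => (⊥ : YoungDiagram)) = ⊥ := by cases n <;> rfl
    rw [chainWeight, h1, ih, h2, hWeight_bot]
    simp

theorem eq_bot_of_chainWeight_ne_zero {n : ℕ} {y : Fin n → ℝ≥0∞} {lam : Fin n → YoungDiagram}
    (h : chainWeight y lam ≠ 0) (htop : top lam = ⊥) : lam = fun _ => ⊥ := by
  induction n with
  | zero => exact Subsingleton.elim _ _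
  | succ n ih =>
    rw [chainWeight] at h
    change lam (Fin.last n) = ⊥ at htop
    rw [htop, hWeight_bot] at h
    have h1 : top (Fin.init lam) = ⊥ := by
      by_contra h1
      simp [h1] at h
    have h2 := ih (left_ne_zero_of_mul h) h1
    funext j
    refine Fin.lastCases htop (fun j => ?_) j
    exact congrFun h2 j

/-- The joint law of the last column of the growth diagram of a weighted matrix. -/
theorem tsum_matrixWeight {m n : ℕ} (u x : Fin m → ℝ≥0∞) (y : Fin n → ℝ≥0∞)
    (G : (Fin n → YoungDiagram) → ℝ≥0∞) :
    ∑' A : Fin m → Fin n → Bool × ℕ, matrixWeight u x y A * G (lastColumn A) =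
      ∑' kap : Fin n → YoungDiagram, chainWeight y kap * superSchur u x (top kap) * G kap := by
  induction m generalizing G with
  | zero =>
    rw [tsum_eq_single (fun i => i.elim0) fun f hf => (hf (Subsingleton.elim _ _)).elim,
      tsum_eq_single fun _ => ⊥]
    · have h2 : top (fun _ : Fin n => (⊥ : YoungDiagram)) = ⊥ := by cases n <;> rfl
      simp [matrixWeight, lastColumn, chainWeight_bot, superSchur, h2]
    · intro kap hkap
      by_cases h : chainWeight y kap = 0
      · simp [h]
      · have : top kap ≠ ⊥ := fun h' => hkap (eq_bot_of_chainWeight_ne_zero h h')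
        simp [superSchur, this]
  | succ m ih =>
    set a := u (Fin.last m)
    set b := x (Fin.last m)
    -- `G₂` sums over the unmarked letters of the last matrix row, `G₁` over all its letters
    let G₂ : (Fin n → YoungDiagram) → ℝ≥0∞ := fun kap =>
      ∑' k : Fin n → ℕ, (∏ j, (b * y j) ^ k j) * G (step hRule kap k)
    let G₁ : (Fin n → YoungDiagram) → ℝ≥0∞ := fun kap =>
      ∑' c : Fin n → Bool, (∏ j, (a * y j) ^ (c j).toNat) *
        G₂ (step (fun lam μ ν b => vRule lam μ ν (Bool.toNat b)) kap c)
    have e1 : ∑' A : Fin (m + 1) → Fin n → Bool × ℕ, matrixWeight u x y A * G (lastColumn A) =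
        ∑' A : Fin m → Fin n → Bool × ℕ,
          matrixWeight (Fin.init u) (Fin.init x) y A * G₁ (lastColumn A) := by
      rw [tsum_fin_succ]
      refine tsum_congr fun A => ?_
      rw [← (Equiv.arrowProdEquivProdArrow (Fin n) (fun _ => Bool) (fun _ => ℕ)).symm.tsum_eq,
        ENNReal.tsum_prod']
      simp only [G₁, G₂, ← ENNReal.tsum_mul_left]
      refine tsum_congr fun c => tsum_congr fun k => ?_
      simp only [matrixWeight, lastColumn, Fin.init_snoc, Fin.snoc_last, Fin.prod_univ_castSucc,
        Fin.snoc_castSucc, Fin.init, Equiv.arrowProdEquivProdArrow, Equiv.coe_fn_symm_mk,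
        Finset.prod_mul_distrib, a, b]
      ring
    rw [e1, ih]
    have e2 : ∑' kap : Fin n → YoungDiagram,
        chainWeight y kap * superSchur (Fin.init u) (Fin.init x) (top kap) * G₁ kap =
        ∑' kap : Fin n → YoungDiagram, chainWeight y kap *
          ∑' μ, vWeight a μ (top kap) * (superSchur (Fin.init u) (Fin.init x) μ * G₂ kap) := by
      rw [← tsum_step (v := fun b (c : Bool) => (a * b) ^ c.toNat)
        (K := fun lam μ ν b => vRule lam μ ν (Bool.toNat b)) (vWeight_bot a)
        (fun b μ ν g => tsum_vRule a b μ ν g) y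
        fun μ kap => superSchur (Fin.init u) (Fin.init x) μ * G₂ kap]
      refine tsum_congr fun kap => ?_
      simp only [G₁, ← ENNReal.tsum_mul_left]
      refine tsum_congr fun c => ?_
      ring
    let S : YoungDiagram → ℝ≥0∞ := fun ν =>
      ∑' μ, vWeight a μ ν * superSchur (Fin.init u) (Fin.init x) μ
    have e3 : ∑' kap : Fin n → YoungDiagram, chainWeight y kap *
          ∑' μ, vWeight a μ (top kap) * (superSchur (Fin.init u) (Fin.init x) μ * G₂ kap) =
        ∑' kap : Fin n → YoungDiagram, chainWeight y kap *
          ∑' μ, hWeight b μ (top kap) * (S μ * G kap) := by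
      rw [← tsum_step (v := fun b' (c : ℕ) => (b * b') ^ c) (hWeight_bot b)
        (fun b' μ ν g => tsum_hRule b b' μ ν g) y fun μ kap => S μ * G kap]
      refine tsum_congr fun kap => ?_
      have hS : ∑' μ, vWeight a μ (top kap) *
          (superSchur (Fin.init u) (Fin.init x) μ * G₂ kap) = S (top kap) * G₂ kap := by
        simp only [S, ← ENNReal.tsum_mul_right, mul_assoc]
      rw [hS]
      simp only [G₂, ← ENNReal.tsum_mul_left]
      refine tsum_congr fun c => ?_
      ring
    rw [e2, e3]
    refine tsum_congr fun kap => ?_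
    simp only [← mul_assoc, ENNReal.tsum_mul_right, superSchur, S, a, b]

/-- The sum of the weights of all columns of length `n` that end in a given diagram. -/
noncomputable def chainSchur : {n : ℕ} → (Fin n → ℝ≥0∞) → YoungDiagram → ℝ≥0∞
  | 0, _, κ => open Classical in if κ = ⊥ then 1 else 0
  | n + 1, y, κ => ∑' ν, chainSchur (Fin.init y) ν * hWeight (y (Fin.last n)) ν κ

theorem tsum_chainWeight {n : ℕ} (y : Fin n → ℝ≥0∞) (g : YoungDiagram → ℝ≥0∞) :
    ∑' kap : Fin n → YoungDiagram, chainWeight y kap * g (top kap) =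
      ∑' κ, chainSchur y κ * g κ := by
  induction n generalizing g with
  | zero =>
    rw [tsum_eq_single Fin.elim0 fun f hf => (hf (Subsingleton.elim _ _)).elim,
      tsum_eq_single ⊥ fun κ hκ => by simp [chainSchur, hκ]]
    simp [chainSchur, chainWeight, top]
  | succ n ih =>
    rw [tsum_fin_succ]
    simp only [chainWeight, top_succ, Fin.init_snoc, Fin.snoc_last, mul_assoc, ENNReal.tsum_mul_left]
    rw [ih (Fin.init y) fun ν => ∑' κ, hWeight (y (Fin.last n)) ν κ * g κ]
    simp only [← ENNReal.tsum_mul_left, chainSchur, ← ENNReal.tsum_mul_right]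
    rw [ENNReal.tsum_comm]
    simp only [mul_assoc]

/-- A Cauchy identity that keeps track of the matrices. -/
theorem tsum_matrixWeight_top {m n : ℕ} (u x : Fin m → ℝ≥0∞) (y : Fin n → ℝ≥0∞)
    (g : YoungDiagram → ℝ≥0∞) :
    ∑' A : Fin m → Fin n → Bool × ℕ, matrixWeight u x y A * g (top (lastColumn A)) =
      ∑' κ, superSchur u x κ * chainSchur y κ * g κ := by
  rw [tsum_matrixWeight u x y fun kap => g (top kap)]
  simp only [mul_assoc]
  rw [tsum_chainWeight y fun κ => superSchur u x κ * g κ]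
  exact tsum_congr fun κ => by ring

/-! ### Schur functions as sums over chains of horizontal strips -/

open Classical in
/-- The cells of a tableau with entries less than `n`. -/
def shapeBelow {κ : YoungDiagram} (T : SemistandardYoungTableau κ) (n : ℕ) : YoungDiagram where
  cells := κ.cells.filter fun c => T c.1 c.2 < n
  isLowerSet := by
    rintro ⟨i, j⟩ ⟨i', j'⟩ ⟨hi, hj⟩ h
    simp only [Finset.coe_filter, YoungDiagram.mem_cells, Set.mem_ofPred_eq] at h ⊢
    simp only at hi hj
    have h1 : (i', j) ∈ κ := κ.up_left_mem hi le_rfl h.1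
    exact ⟨κ.up_left_mem hi hj h.1, lt_of_le_of_lt
      ((T.row_weak_of_le hj h1).trans (T.col_weak hi h.1)) h.2⟩

theorem mem_shapeBelow {κ : YoungDiagram} {T : SemistandardYoungTableau κ} {n i j : ℕ} :
    (i, j) ∈ shapeBelow T n ↔ (i, j) ∈ κ ∧ T i j < n := by
  rw [← YoungDiagram.mem_cells]
  simp [shapeBelow]

open Classical in
/-- The part of a tableau that consists of the entries less than `n`. -/
def restrictBelow {κ : YoungDiagram} (T : SemistandardYoungTableau κ) (n : ℕ) :
    SemistandardYoungTableau (shapeBelow T n) where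
  entry i j := if (i, j) ∈ shapeBelow T n then T i j else 0
  row_weak' {i j1 j2} hj h := by
    rw [if_pos h, if_pos ((shapeBelow T n).up_left_mem le_rfl hj.le h)]
    exact T.row_weak hj (mem_shapeBelow.mp h).1
  col_strict' {i1 i2 j} hi h := by
    rw [if_pos h, if_pos ((shapeBelow T n).up_left_mem hi.le le_rfl h)]
    exact T.col_strict hi (mem_shapeBelow.mp h).1
  zeros' h := if_neg h

open Classical in
theorem restrictBelow_apply {κ : YoungDiagram} (T : SemistandardYoungTableau κ) (n i j : ℕ) :
    restrictBelow T n i j = if (i, j) ∈ shapeBelow T n then T i j else 0 := rfl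

theorem HStrip.mem_of_mem {ν κ : YoungDiagram} (h : HStrip ν κ) {i j : ℕ} (hij : (i, j) ∈ ν) :
    (i, j) ∈ κ := by
  rw [YoungDiagram.mem_iff_lt_rowLen] at *
  exact hij.trans_le (h i).1

theorem HStrip.mem_of_succ_mem {ν κ : YoungDiagram} (h : HStrip ν κ) {i j : ℕ}
    (hij : (i + 1, j) ∈ κ) : (i, j) ∈ ν := by
  rw [YoungDiagram.mem_iff_lt_rowLen] at *
  exact hij.trans_le (h i).2

open Classical in
/-- The tableau of shape `κ` obtained from a tableau `T` with entries less than `n` by filling the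
cells of the horizontal strip `κ / ν` with `n`. -/
def fillStrip {ν κ : YoungDiagram} (h : HStrip ν κ) (T : SemistandardYoungTableau ν) (n : ℕ)
    (hT : ∀ i j, (i, j) ∈ ν → T i j < n) : SemistandardYoungTableau κ where
  entry i j := if (i, j) ∈ ν then T i j else if (i, j) ∈ κ then n else 0
  row_weak' {i j1 j2} hj hκ := by
    by_cases h2 : (i, j2) ∈ ν
    · rw [if_pos h2, if_pos (ν.up_left_mem le_rfl hj.le h2)]
      exact T.row_weak hj h2
    · rw [if_neg h2, if_pos hκ]
      split_ifs with h1
      · exact (hT _ _ h1).le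
      · exact le_rfl
      · exact Nat.zero_le _
  col_strict' {i1 i2 j} hi hκ := by
    have h1 : (i1, j) ∈ ν := h.mem_of_succ_mem (κ.up_left_mem (by omega) le_rfl hκ)
    rw [if_pos h1]
    by_cases h2 : (i2, j) ∈ ν
    · rw [if_pos h2]
      exact T.col_strict hi h2
    · rw [if_neg h2, if_pos hκ]
      exact hT _ _ h1
  zeros' {i j} hκ := by
    rw [if_neg fun hν => hκ (h.mem_of_mem hν), if_neg hκ]

open Classical in
theorem fillStrip_apply {ν κ : YoungDiagram} (h : HStrip ν κ) (T : SemistandardYoungTableau ν)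
    (n : ℕ) (hT : ∀ i j, (i, j) ∈ ν → T i j < n) (i j : ℕ) :
    fillStrip h T n hT i j = if (i, j) ∈ ν then T i j else if (i, j) ∈ κ then n else 0 := rfl

theorem sigma_tableau_ext {p q : (ν : YoungDiagram) × SemistandardYoungTableau ν}
    (h1 : p.1 = q.1) (h2 : ∀ i j, p.2 i j = q.2 i j) : p = q := by
  obtain ⟨ν, T⟩ := p
  obtain ⟨ν', T'⟩ := q
  obtain rfl : ν = ν' := h1
  obtain rfl : T = T' := SemistandardYoungTableau.ext h2
  rfl

/-- Tableaux with entries at most `n` correspond to tableaux with entries less than `n` on a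
smaller shape, the difference of the shapes being a horizontal strip. -/
theorem restrictBelow_bijOn (κ : YoungDiagram) (n : ℕ) :
    Set.BijOn (fun T : SemistandardYoungTableau κ =>
        (⟨shapeBelow T n, restrictBelow T n⟩ : (ν : YoungDiagram) × SemistandardYoungTableau ν))
      {T | ∀ i j, (i, j) ∈ κ → T i j < n + 1}
      {p | HStrip p.1 κ ∧ ∀ i j, (i, j) ∈ p.1 → p.2 i j < n} := by
  refine ⟨?_, ?_, ?_⟩
  · intro T hT
    refine ⟨fun r => ⟨?_, ?_⟩, fun i j hij => ?_⟩
    · refine le_of_forall_lt fun j hj => ?_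
      rw [← YoungDiagram.mem_iff_lt_rowLen] at *
      exact (mem_shapeBelow.mp hj).1
    · refine le_of_forall_lt fun j hj => ?_
      rw [← YoungDiagram.mem_iff_lt_rowLen] at *
      refine mem_shapeBelow.mpr ⟨κ.up_left_mem (Nat.le_succ r) le_rfl hj, ?_⟩
      have h1 := T.col_strict (Nat.lt_add_one r) hj
      have h2 := hT _ _ hj
      omega
    · simp only [restrictBelow_apply]
      rw [if_pos hij]
      exact (mem_shapeBelow.mp hij).2
  · intro T hT T' hT' h
    refine SemistandardYoungTableau.ext fun i j => ?_
    have h1 : (i, j) ∈ shapeBelow T n ↔ (i, j) ∈ shapeBelow T' n := by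
      rw [show shapeBelow T n = shapeBelow T' n from congrArg Sigma.fst h]
    have h2 : restrictBelow T n i j = restrictBelow T' n i j :=
      congrArg (fun p : (ν : YoungDiagram) × SemistandardYoungTableau ν => p.2 i j) h
    by_cases hκ : (i, j) ∈ κ
    · by_cases hν : (i, j) ∈ shapeBelow T n
      · rwa [restrictBelow_apply, restrictBelow_apply, if_pos hν, if_pos (h1.mp hν)] at h2
      · have a1 := hT _ _ hκ
        have a2 := hT' _ _ hκ
        have a3 : ¬ T i j < n := fun h => hν (mem_shapeBelow.mpr ⟨hκ, h⟩)
        have a4 : ¬ T' i j < n := fun h => hν (h1.mpr (mem_shapeBelow.mpr ⟨hκ, h⟩))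
        omega
    · rw [T.zeros hκ, T'.zeros hκ]
  · rintro ⟨ν, T⟩ ⟨h, hT⟩
    have hmem : ∀ i j, (i, j) ∈ shapeBelow (fillStrip h T n hT) n ↔ (i, j) ∈ ν := by
      intro i j
      rw [mem_shapeBelow, fillStrip_apply]
      constructor
      · rintro ⟨h1, h2⟩
        by_contra h3
        rw [if_neg h3, if_pos h1] at h2
        omega
      · intro h1
        rw [if_pos h1]
        exact ⟨h.mem_of_mem h1, hT _ _ h1⟩
    refine ⟨fillStrip h T n hT, fun i j hκ => ?_, sigma_tableau_ext ?_ fun i j => ?_⟩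
    · rw [fillStrip_apply]
      split_ifs with h1
      · exact Nat.lt_succ_of_lt (hT _ _ h1)
      · exact Nat.lt_succ_self n
    · ext ⟨i, j⟩
      exact hmem i j
    · simp only [restrictBelow_apply, hmem, fillStrip_apply]
      split_ifs with h1
      · rfl
      · exact (T.zeros h1).symm

/-- The sum of the monomials of the tableaux of shape `κ`, with values in `ℝ≥0∞`. -/
noncomputable def tableauSum {n : ℕ} (y : Fin n → ℝ≥0∞) (κ : YoungDiagram) : ℝ≥0∞ :=
  ∑' T : SemistandardYoungTableau κ,
    ∏ c ∈ κ.cells, if hk : T c.1 c.2 < n then y ⟨T c.1 c.2, hk⟩ else 0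

theorem tableauSum_eq_zero_of_le {n : ℕ} (y : Fin n → ℝ≥0∞) {κ : YoungDiagram}
    {T : SemistandardYoungTableau κ} (h : ¬ ∀ i j, (i, j) ∈ κ → T i j < n) :
    (∏ c ∈ κ.cells, if hk : T c.1 c.2 < n then y ⟨T c.1 c.2, hk⟩ else 0) = 0 := by
  push Not at h
  obtain ⟨i, j, hκ, hij⟩ := h
  exact Finset.prod_eq_zero (i := (i, j)) hκ (dif_neg (not_lt.mpr hij))

theorem tableauSum_succ {n : ℕ} (y : Fin (n + 1) → ℝ≥0∞) (κ : YoungDiagram) :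
    tableauSum y κ = ∑' ν, tableauSum (Fin.init y) ν * hWeight (y (Fin.last n)) ν κ := by
  simp only [tableauSum, ← ENNReal.tsum_mul_right]
  rw [← ENNReal.tsum_sigma' (f := fun p : (ν : YoungDiagram) × SemistandardYoungTableau ν =>
    (∏ c ∈ p.1.cells, if hk : p.2 c.1 c.2 < n then
      Fin.init (α := fun _ => ℝ≥0∞) y ⟨p.2 c.1 c.2, hk⟩ else 0) * hWeight (y (Fin.last n)) p.1 κ)]
  refine tsum_eq_tsum_of_bijOn _ (restrictBelow_bijOn κ n) ?_ ?_ ?_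
  · intro T hT
    exact tableauSum_eq_zero_of_le y hT
  · rintro ⟨ν, T⟩ hp
    by_cases h1 : HStrip ν κ
    · simp only
      rw [tableauSum_eq_zero_of_le (Fin.init y) (T := T) fun h2 => hp ⟨h1, h2⟩, zero_mul]
    · simp [hWeight, h1]
  · intro T hT
    have hmaps := (restrictBelow_bijOn κ n).mapsTo hT
    have hstrip : HStrip (shapeBelow T n) κ := hmaps.1
    simp only [hWeight]
    rw [if_pos hstrip]
    have hcells : (shapeBelow T n).cells = κ.cells.filter fun c => T c.1 c.2 < n := by
      ext ⟨i, j⟩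
      rw [YoungDiagram.mem_cells, mem_shapeBelow, Finset.mem_filter, YoungDiagram.mem_cells]
    rw [← Finset.prod_filter_mul_prod_filter_not κ.cells fun c => T c.1 c.2 < n, ← hcells]
    congr 1
    · refine Finset.prod_congr rfl fun c hc => ?_
      have h1 : (c.1, c.2) ∈ shapeBelow T n := hc
      have h2 := (mem_shapeBelow.mp h1).2
      simp only [restrictBelow_apply, if_pos h1]
      rw [dif_pos (Nat.lt_succ_of_lt h2), dif_pos h2]
      rfl
    · have hcard : κ.card - (shapeBelow T n).card =
          (κ.cells.filter fun c => ¬ T c.1 c.2 < n).card := by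
        have := Finset.card_filter_add_card_filter_not (s := κ.cells) fun c => T c.1 c.2 < n
        rw [YoungDiagram.card, YoungDiagram.card, hcells]
        omega
      rw [hcard, ← Finset.prod_const]
      refine Finset.prod_congr rfl fun c hc => ?_
      rw [Finset.mem_filter] at hc
      have h1 := hT c.1 c.2 hc.1
      have h2 : T c.1 c.2 = n := by have := hc.2; omega
      rw [dif_pos h1]
      congr 1
      exact Fin.ext h2

theorem tableauSum_eq_chainSchur {n : ℕ} (y : Fin n → ℝ≥0∞) (κ : YoungDiagram) :
    tableauSum y κ = chainSchur y κ := by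
  induction n generalizing κ with
  | zero =>
    rw [chainSchur]
    split_ifs with h
    · subst h
      have hT : ∀ T : SemistandardYoungTableau ⊥, T = default := fun T =>
        SemistandardYoungTableau.ext fun i j => by
          rw [T.zeros (YoungDiagram.notMem_bot _), SemistandardYoungTableau.zeros _
            (YoungDiagram.notMem_bot _)]
      rw [tableauSum, tsum_eq_single default fun T h => (h (hT T)).elim]
      simp
    · rw [tableauSum, ENNReal.tsum_eq_zero]
      intro T
      refine tableauSum_eq_zero_of_le y fun hT => h ?_
      ext ⟨i, j⟩
      simp only [YoungDiagram.mem_cells, YoungDiagram.notMem_bot, iff_false]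
      exact fun hij => Nat.not_lt_zero _ (hT i j hij)
  | succ n ih =>
    rw [tableauSum_succ, chainSchur]
    simp only [ih]

theorem schur_term_nonneg {n : ℕ} {y : Fin n → ℝ} (hy : ∀ j, 0 ≤ y j) {κ : YoungDiagram}
    (T : SemistandardYoungTableau κ) : 0 ≤ ∏ c ∈ κ.cells, extend y (T c.1 c.2) := by
  refine Finset.prod_nonneg fun c _ => ?_
  rw [extend]
  split_ifs
  · exact hy _
  · exact le_rfl

theorem schur_nonneg {n : ℕ} {y : Fin n → ℝ} (hy : ∀ j, 0 ≤ y j) (κ : YoungDiagram) :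
    0 ≤ schur y κ :=
  finsum_nonneg fun T => schur_term_nonneg hy T

theorem ofReal_schur {n : ℕ} {y : Fin n → ℝ} (hy : ∀ j, 0 ≤ y j) (κ : YoungDiagram) :
    ENNReal.ofReal (schur y κ) = chainSchur (fun j => ENNReal.ofReal (y j)) κ := by
  have hfin := schur_finite_support y κ
  rw [← tableauSum_eq_chainSchur, schur, ← tsum_eq_finsum (L := SummationFilter.unconditional _) hfin,
    ENNReal.ofReal_tsum_of_nonneg (fun T => schur_term_nonneg hy T)
      (summable_of_hasFiniteSupport hfin), tableauSum]
  refine tsum_congr fun T => ?_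
  rw [ENNReal.ofReal_prod_of_nonneg]
  · refine Finset.prod_congr rfl fun c _ => ?_
    rw [extend]
    split_ifs
    · rfl
    · exact ENNReal.ofReal_zero
  · intro c _
    rw [extend]
    split_ifs
    · exact hy _
    · exact le_rfl

/-! ### Strips described by columns -/

theorem HStrip.transpose {ν κ : YoungDiagram} (h : HStrip ν κ) :
    VStrip ν.transpose κ.transpose := by
  intro j
  rw [YoungDiagram.rowLen_transpose, YoungDiagram.rowLen_transpose]
  constructor
  · refine le_of_forall_lt fun i hi => ?_
    rw [← YoungDiagram.mem_iff_lt_colLen] at *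
    exact h.mem_of_mem hi
  · refine le_of_forall_lt fun i hi => ?_
    rw [← YoungDiagram.mem_iff_lt_colLen] at hi
    cases i with
    | zero => exact Nat.succ_pos _
    | succ i => exact Nat.succ_lt_succ (YoungDiagram.mem_iff_lt_colLen.mp (h.mem_of_succ_mem hi))

theorem VStrip.transpose {ν κ : YoungDiagram} (h : VStrip ν κ) :
    HStrip ν.transpose κ.transpose := by
  intro j
  simp only [YoungDiagram.rowLen_transpose]
  constructor
  · refine le_of_forall_lt fun i hi => ?_
    rw [← YoungDiagram.mem_iff_lt_colLen, YoungDiagram.mem_iff_lt_rowLen] at *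
    exact hi.trans_le (h i).1
  · refine le_of_forall_lt fun i hi => ?_
    rw [← YoungDiagram.mem_iff_lt_colLen, YoungDiagram.mem_iff_lt_rowLen] at *
    have := (h i).2
    omega

theorem hStrip_iff_colLen {ν κ : YoungDiagram} :
    HStrip ν κ ↔ ∀ j, ν.colLen j ≤ κ.colLen j ∧ κ.colLen j ≤ ν.colLen j + 1 := by
  have h : HStrip ν κ ↔ VStrip ν.transpose κ.transpose :=
    ⟨HStrip.transpose, fun h => by simpa using h.transpose⟩
  simp only [h, VStrip, YoungDiagram.rowLen_transpose]

theorem vStrip_iff_colLen {ν κ : YoungDiagram} :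
    VStrip ν κ ↔ ∀ j, ν.colLen j ≤ κ.colLen j ∧ κ.colLen (j + 1) ≤ ν.colLen j := by
  have h : VStrip ν κ ↔ HStrip ν.transpose κ.transpose :=
    ⟨VStrip.transpose, fun h => by simpa using h.transpose⟩
  simp only [h, HStrip, YoungDiagram.rowLen_transpose]

theorem card_transpose (μ : YoungDiagram) : μ.transpose.card = μ.card := by
  simp [YoungDiagram.card, YoungDiagram.transpose]

theorem card_eq_sum_colLen (μ : YoungDiagram) {N : ℕ} (hN : ∀ r, N ≤ r → μ.colLen r = 0) :
    μ.card = ∑ i : Fin N, μ.colLen i := by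
  rw [← card_transpose, card_eq_sum_rowLen μ.transpose (N := N) (by simpa using hN),
    Fin.sum_univ_eq_sum_range fun i => μ.colLen i]
  simp

theorem colLen_eq_zero_iff {μ : YoungDiagram} {j : ℕ} : μ.colLen j = 0 ↔ μ.rowLen 0 ≤ j := by
  rw [← not_lt, ← YoungDiagram.mem_iff_lt_rowLen, YoungDiagram.mem_iff_lt_colLen]
  omega

theorem ext_colLen {μ ν : YoungDiagram} (h : ∀ i, μ.colLen i = ν.colLen i) : μ = ν := by
  rw [← YoungDiagram.transpose_eq_iff]
  exact ext_rowLen fun i => by simpa using h i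

/-! ### Jacobi–Trudi determinants of power series -/

/-- The coefficient of `z ^ k` in a power series, for an integer `k`. -/
noncomputable def intCoeff (E : PowerSeries ℝ) (k : ℤ) : ℝ :=
  if 0 ≤ k then PowerSeries.coeff k.toNat E else 0

theorem intCoeff_of_neg (E : PowerSeries ℝ) {k : ℤ} (hk : k < 0) : intCoeff E k = 0 :=
  if_neg (not_le.mpr hk)

theorem intCoeff_natCast (E : PowerSeries ℝ) (k : ℕ) :
    intCoeff E k = PowerSeries.coeff k E := by
  simp [intCoeff]

theorem intCoeff_mul_linear (E : PowerSeries ℝ) (a : ℝ) (k : ℤ) :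
    intCoeff (E * (1 + PowerSeries.C a * PowerSeries.X)) k =
      intCoeff E k + a * intCoeff E (k - 1) := by
  rcases lt_or_ge k 0 with hk | hk
  · rw [intCoeff_of_neg _ hk, intCoeff_of_neg _ hk, intCoeff_of_neg _ (by omega)]
    simp
  · lift k to ℕ using hk
    have h : E * (1 + PowerSeries.C a * PowerSeries.X) =
        E + PowerSeries.C a * (E * PowerSeries.X) := by ring
    rw [h, intCoeff_natCast, intCoeff_natCast, map_add, PowerSeries.coeff_C_mul]
    cases k with
    | zero =>
      rw [intCoeff_of_neg _ (by simp)]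
      simp
    | succ k =>
      rw [PowerSeries.coeff_succ_mul_X, show ((k + 1 : ℕ) : ℤ) - 1 = (k : ℕ) by push_cast; ring,
        intCoeff_natCast]

/-- The Jacobi–Trudi determinant of size `N` for a sequence `c` of column lengths. -/
noncomputable def jacobiTrudi (N : ℕ) (E : PowerSeries ℝ) (c : ℕ → ℤ) : ℝ :=
  Matrix.det (Matrix.of fun i j : Fin N => intCoeff E (c i - (i : ℤ) + (j : ℤ)))

/-- The Jacobi–Trudi determinant of a Young diagram. -/
noncomputable def diagramDet (E : PowerSeries ℝ) (μ : YoungDiagram) : ℝ :=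
  jacobiTrudi (μ.rowLen 0) E fun i => μ.colLen i

theorem genSchur_eq_diagramDet {m : ℕ} (x : Fin m → ℝ) (t : ℝ) (μ : YoungDiagram) :
    genSchur x t μ = diagramDet (genSeries x t) μ := rfl

theorem jacobiTrudi_succ {N : ℕ} {E : PowerSeries ℝ} (hE : PowerSeries.constantCoeff E = 1)
    {c : ℕ → ℤ} (hc : c N = 0) : jacobiTrudi (N + 1) E c = jacobiTrudi N E c := by
  rw [jacobiTrudi, Matrix.det_succ_row _ (Fin.last N), Fin.sum_univ_castSucc,
    Finset.sum_eq_zero, zero_add]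
  · have h : intCoeff E (c N - (N : ℤ) + (N : ℤ)) = 1 := by
      rw [hc, show (0 : ℤ) - N + N = (0 : ℕ) by simp, intCoeff_natCast]
      simpa using hE
    simp only [Matrix.of_apply, Fin.val_last, h, Fin.succAbove_last]
    rw [Even.neg_one_pow ⟨N, rfl⟩, one_mul, one_mul]
    rfl
  · intro j _
    simp only [Matrix.of_apply, Fin.val_last, hc]
    rw [intCoeff_of_neg _ (by have := j.isLt; simp only [Fin.val_castSucc]; omega)]
    simp

/-- The size of the determinant may be enlarged beyond the number of columns of the diagram. -/
theorem jacobiTrudi_eq_diagramDet {N : ℕ} {E : PowerSeries ℝ}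
    (hE : PowerSeries.constantCoeff E = 1) {μ : YoungDiagram} (hN : μ.rowLen 0 ≤ N) :
    jacobiTrudi N E (fun i => μ.colLen i) = diagramDet E μ := by
  induction N, hN using Nat.le_induction with
  | base => rfl
  | succ N hN ih =>
    rw [jacobiTrudi_succ hE, ih]
    exact_mod_cast colLen_eq_zero_iff.mpr hN

theorem det_sum_rows {N : ℕ} (u : ℝ) (a : Fin N → ℕ) (f : Fin N → ℕ → Fin N → ℝ) :
    Matrix.det (Matrix.of fun i j => ∑ r ∈ Finset.range (a i), u ^ r * f i r j) =
      ∑ r ∈ Fintype.piFinset fun i => Finset.range (a i),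
        u ^ (∑ i, r i) * Matrix.det (Matrix.of fun i j => f i (r i) j) := by
  have h := (Matrix.detRowAlternating (R := ℝ) (n := Fin N)).toMultilinearMap.map_sum_finset
    (fun i r => u ^ r • f i r) fun i => Finset.range (a i)
  have h1 : (fun i => ∑ r ∈ Finset.range (a i), u ^ r • f i r) =
      Matrix.of fun i j => ∑ r ∈ Finset.range (a i), u ^ r * f i r j := by
    ext i j
    simp
  rw [h1] at h
  refine h.trans (Finset.sum_congr rfl fun r _ => ?_)
  rw [MultilinearMap.map_smul_univ, Finset.prod_pow_eq_pow_sum]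
  rfl

theorem ofReal_sum_eq_tsum_of_bijOn {α β : Type*} {s : Finset β} {F : β → ℝ} {f : α → ℝ≥0∞}
    {S : Set α} {T : Set β} (K : α → β) (hK : Set.BijOn K S T) (hTs : T ⊆ s)
    (hF : ∀ b ∈ s, b ∉ T → F b = 0) (hF0 : ∀ b ∈ T, 0 ≤ F b) (hf : ∀ a, a ∉ S → f a = 0)
    (h : ∀ a ∈ S, f a = ENNReal.ofReal (F (K a))) :
    0 ≤ ∑ b ∈ s, F b ∧ ENNReal.ofReal (∑ b ∈ s, F b) = ∑' a, f a := by
  have h0 : ∀ b ∈ s, 0 ≤ F b := by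
    intro b hb
    by_cases hbT : b ∈ T
    · exact hF0 b hbT
    · exact (hF b hb hbT).ge
  refine ⟨Finset.sum_nonneg h0, ?_⟩
  classical
  rw [tsum_eq_tsum_of_bijOn (F := fun b => if b ∈ T then ENNReal.ofReal (F b) else 0) K hK hf
    (fun b hb => if_neg hb) fun a ha => by rw [h a ha, if_pos (hK.mapsTo ha)],
    tsum_eq_sum (s := s) fun b hb => if_neg fun hbT => hb (hTs hbT),
    ENNReal.ofReal_sum_of_nonneg h0]
  refine Finset.sum_congr rfl fun b hb => ?_
  split_ifs with hbT
  · rfl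
  · rw [hF b hb hbT, ENNReal.ofReal_zero]

open Classical in
/-- The passage from a multilinear expansion of a Jacobi–Trudi determinant, in which up to
`a i - 1` cells are removed from column `i`, to a sum over Young diagrams. The hypothesis `hvan`
says that the terms which do not belong to a diagram vanish. -/
theorem diagramDet_expand {E E' : PowerSeries ℝ} (hE : PowerSeries.constantCoeff E = 1)
    (hpos : ∀ ν, 0 ≤ diagramDet E ν) {u : ℝ} (hu : 0 ≤ u) (κ : YoungDiagram) {a : ℕ → ℕ}
    (ha : ∀ i, i < κ.rowLen 0 → a i ≤ κ.colLen i + 1) {P : YoungDiagram → Prop}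
    (hP : ∀ ν, P ν ↔ ∀ i, ν.colLen i ≤ κ.colLen i ∧
      (i < κ.rowLen 0 → κ.colLen i < ν.colLen i + a i))
    (hvan : ∀ r : ℕ → ℕ, (∀ i, i < κ.rowLen 0 → r i < a i) → ∀ i, i + 1 < κ.rowLen 0 →
      κ.colLen i - r i < κ.colLen (i + 1) - r (i + 1) →
      (κ.colLen i : ℤ) - r i - i = (κ.colLen (i + 1) : ℤ) - r (i + 1) - (i + 1))
    (hdet : diagramDet E' κ =
      Matrix.det (Matrix.of fun i j : Fin (κ.rowLen 0) => ∑ r ∈ Finset.range (a i),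
        u ^ r * intCoeff E ((κ.colLen i : ℤ) - r - i + j))) :
    0 ≤ diagramDet E' κ ∧ ENNReal.ofReal (diagramDet E' κ) =
      ∑' ν, (if P ν then ENNReal.ofReal u ^ (κ.card - ν.card) else 0) *
        ENNReal.ofReal (diagramDet E ν) := by
  rw [hdet, det_sum_rows u (fun i => a i)
    fun i r j => intCoeff E ((κ.colLen i : ℤ) - r - i + j)]
  have hκ0 : ∀ i, κ.rowLen 0 ≤ i → κ.colLen i = 0 := fun i hi => colLen_eq_zero_iff.mpr hi
  -- the determinant belonging to the removal of the cells of a strip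
  have hterm : ∀ ν, P ν → Matrix.det (Matrix.of fun i j : Fin (κ.rowLen 0) =>
      intCoeff E ((κ.colLen i : ℤ) - (κ.colLen i - ν.colLen i : ℕ) - i + j)) =
        diagramDet E ν := by
    intro ν hν
    rw [hP] at hν
    have hle : ν.rowLen 0 ≤ κ.rowLen 0 := by
      rw [← colLen_eq_zero_iff]
      have := (hν (κ.rowLen 0)).1
      rw [hκ0 _ le_rfl] at this
      omega
    rw [← jacobiTrudi_eq_diagramDet hE hle, jacobiTrudi]
    congr 2
    funext i j
    congr 1
    have := (hν i).1
    push_cast [this]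
    ring
  have hbij : Set.BijOn
      (fun (ν : YoungDiagram) (i : Fin (κ.rowLen 0)) => κ.colLen i - ν.colLen i)
      {ν | P ν} {r | (∀ i, r i < a i) ∧ ∃ ν, P ν ∧ ∀ i, r i = κ.colLen i - ν.colLen i} := by
    refine ⟨fun ν hν => ⟨fun i => ?_, ν, hν, fun i => rfl⟩, fun ν hν ν' hν' h => ?_, ?_⟩
    · have := ((hP ν).mp hν i).2 i.isLt
      have := ((hP ν).mp hν i).1
      simp only
      omega
    · refine ext_colLen fun i => ?_
      have h1 := ((hP ν).mp hν i).1
      have h2 := ((hP ν').mp hν' i).1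
      by_cases hi : i < κ.rowLen 0
      · have := congrFun h ⟨i, hi⟩
        simp only at this
        omega
      · rw [hκ0 i (not_lt.mp hi)] at h1 h2
        omega
    · rintro r ⟨hr, ν, hν, hrν⟩
      exact ⟨ν, hν, (funext hrν).symm⟩
  refine ofReal_sum_eq_tsum_of_bijOn _ hbij ?_ ?_ ?_ ?_ ?_
  · rintro r ⟨hr, -⟩
    simpa using hr
  · intro r hr hrT
    simp only [Fintype.mem_piFinset, Finset.mem_range] at hr
    let r' : ℕ → ℕ := fun i => if hi : i < κ.rowLen 0 then r ⟨i, hi⟩ else 0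
    have hr' : ∀ i : Fin (κ.rowLen 0), r' i = r i := fun i => dif_pos i.isLt
    have hr'a : ∀ i, i < κ.rowLen 0 → r' i < a i := fun i hi => by
      simpa only [r', dif_pos hi] using hr ⟨i, hi⟩
    have hex : ∃ i, κ.colLen i - r' i < κ.colLen (i + 1) - r' (i + 1) := by
      by_contra hno
      push Not at hno
      refine hrT ⟨hr, ?_⟩
      have hf0 : ∃ N, (fun i => κ.colLen i - r' i) N = 0 :=
        ⟨κ.rowLen 0, by simp [hκ0 _ le_rfl]⟩
      have hcol : ∀ i, (ofRows _ hf0).transpose.colLen i = κ.colLen i - r' i := fun i => by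
        rw [YoungDiagram.colLen_transpose, rowLen_ofRows hf0 hno]
      refine ⟨(ofRows _ hf0).transpose, (hP _).mpr fun i => ?_, fun i => ?_⟩
      · rw [hcol]
        refine ⟨Nat.sub_le _ _, fun hi => ?_⟩
        have := hr'a i hi
        omega
      · rw [hcol, hr']
        have h1 := hr i
        have h2 := ha i i.isLt
        omega
    obtain ⟨i, hi⟩ := hex
    have hiN : i + 1 < κ.rowLen 0 := by
      by_contra h
      rw [hκ0 (i + 1) (not_lt.mp h)] at hi
      omega
    have hrow := hvan r' hr'a i hiN hi
    rw [Matrix.det_zero_of_row_eq (i := ⟨i, by omega⟩) (j := ⟨i + 1, hiN⟩), mul_zero]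
    · simp
    · funext j
      simp only [Matrix.of_apply, ← hr']
      rw [hrow]
      push_cast
      rfl
  · rintro r ⟨hr, ν, hν, hrν⟩
    obtain rfl := funext hrν
    rw [hterm ν hν]
    exact mul_nonneg (pow_nonneg hu _) (hpos ν)
  · intro ν hν
    change ¬ P ν at hν
    rw [if_neg hν, zero_mul]
  · intro ν hν
    change P ν at hν
    dsimp only
    rw [if_pos hν, hterm ν hν, ENNReal.ofReal_mul (pow_nonneg hu _), ENNReal.ofReal_pow hu]
    congr 2
    have hν' := (hP ν).mp hν
    rw [card_eq_sum_colLen κ hκ0, card_eq_sum_colLen ν (N := κ.rowLen 0) fun i hi => by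
        have := (hν' i).1
        rw [hκ0 i hi] at this
        omega]
    exact (Finset.sum_tsub_distrib _ fun (i : Fin (κ.rowLen 0)) _ => (hν' i).1).symm

/-- Multiplying the series by `1 + a z` adds a horizontal strip: each row of the determinant
splits into two, and a choice of summands that does not belong to a partition gives two equal
rows. -/
theorem diagramDet_mul_linear {E : PowerSeries ℝ} (hE : PowerSeries.constantCoeff E = 1)
    (hpos : ∀ ν, 0 ≤ diagramDet E ν) {u : ℝ} (hu : 0 ≤ u) (κ : YoungDiagram) :
    0 ≤ diagramDet (E * (1 + PowerSeries.C u * PowerSeries.X)) κ ∧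
      ENNReal.ofReal (diagramDet (E * (1 + PowerSeries.C u * PowerSeries.X)) κ) =
        ∑' ν, hWeight (ENNReal.ofReal u) ν κ * ENNReal.ofReal (diagramDet E ν) := by
  have hκ : ∀ i, i < κ.rowLen 0 → κ.colLen i ≠ 0 := fun i hi h =>
    absurd (colLen_eq_zero_iff.mp h) (by omega)
  refine diagramDet_expand hE hpos hu κ (a := fun _ => 2) ?_ ?_ ?_ ?_
  · intro i hi
    have := hκ i hi
    omega
  · intro ν
    rw [hStrip_iff_colLen]
    refine forall_congr' fun i => and_congr_right fun h => ⟨fun h' _ => by omega, fun h' => ?_⟩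
    by_cases hi : i < κ.rowLen 0
    · have := h' hi
      omega
    · rw [colLen_eq_zero_iff.mpr (not_lt.mp hi)]
      omega
  · intro r hr i hi h
    have h1 := hr i (by omega)
    have h2 := hr (i + 1) hi
    have h3 := κ.colLen_anti i (i + 1) (by omega)
    have h4 := hκ i (by omega)
    omega
  · rw [diagramDet, jacobiTrudi]
    congr 2
    funext i j
    rw [intCoeff_mul_linear]
    simp only [Finset.sum_range_succ, Finset.sum_range_zero, pow_zero, pow_one, one_mul, zero_add]
    simp only [Nat.cast_zero, sub_zero, Nat.cast_one]
    congr 3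
    ring

theorem intCoeff_geometric {E E' : PowerSeries ℝ} {u : ℝ}
    (h : E = E' * (1 + PowerSeries.C (-u) * PowerSeries.X)) (k : ℤ) (L : ℕ) :
    intCoeff E' k - u ^ L * intCoeff E' (k - L) =
      ∑ r ∈ Finset.range L, u ^ r * intCoeff E (k - r) := by
  induction L with
  | zero => simp
  | succ L ih =>
    rw [Finset.sum_range_succ, ← ih, h, intCoeff_mul_linear,
      show k - ((L + 1 : ℕ) : ℤ) = k - L - 1 by push_cast; ring]
    ring

/-- Dividing the series by `1 - u z` adds a vertical strip. Subtracting a multiple of the next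
row from every row leaves exactly the summands that belong to such strips. -/
theorem diagramDet_div_linear {E E' : PowerSeries ℝ} (hE : PowerSeries.constantCoeff E = 1)
    (hpos : ∀ ν, 0 ≤ diagramDet E ν) {u : ℝ} (hu : 0 ≤ u)
    (h : E = E' * (1 + PowerSeries.C (-u) * PowerSeries.X)) (κ : YoungDiagram) :
    0 ≤ diagramDet E' κ ∧ ENNReal.ofReal (diagramDet E' κ) =
      ∑' ν, vWeight (ENNReal.ofReal u) ν κ * ENNReal.ofReal (diagramDet E ν) := by
  have hanti : ∀ i, κ.colLen (i + 1) ≤ κ.colLen i := fun i => κ.colLen_anti i (i + 1) (by omega)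
  refine diagramDet_expand hE hpos hu κ
    (a := fun i => κ.colLen i - κ.colLen (i + 1) + 1) ?_ ?_ ?_ ?_
  · intro i hi
    omega
  · intro ν
    rw [vStrip_iff_colLen]
    refine forall_congr' fun i => and_congr_right fun h => ?_
    have h3 := hanti i
    constructor
    · intro h' _
      omega
    · intro h'
      by_cases hi : i < κ.rowLen 0
      · have := h' hi
        omega
      · rw [colLen_eq_zero_iff.mpr (show κ.rowLen 0 ≤ i + 1 by omega)]
        omega
  · intro r hr i hi h
    have h1 := hr i (by omega)
    have h3 := hanti i
    omega
  · -- the row operation is the multiplication by a unitriangular matrix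
    let U : Matrix (Fin (κ.rowLen 0)) (Fin (κ.rowLen 0)) ℝ := Matrix.of fun i j =>
      (if (j : ℕ) = i then 1 else 0) +
        (if (j : ℕ) = i + 1 then -u ^ (κ.colLen i - κ.colLen (i + 1) + 1) else 0)
    have hU : U.det = 1 := by
      rw [Matrix.det_of_isUpperTriangular]
      · refine Finset.prod_eq_one fun i _ => ?_
        simp [U]
      · intro i j hij
        have hij' : (j : ℕ) < i := hij
        simp only [U, Matrix.of_apply]
        rw [if_neg (by omega), if_neg (by omega), add_zero]
    rw [diagramDet, jacobiTrudi, ← one_mul (Matrix.det _), ← hU, ← Matrix.det_mul]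
    congr 1
    ext i k
    rw [Matrix.mul_apply, Matrix.of_apply]
    have hsum : ∑ j, U i j * (Matrix.of fun i j : Fin (κ.rowLen 0) =>
        intCoeff E' ((κ.colLen i : ℤ) - (i : ℤ) + (j : ℤ))) j k =
        ∑ j ∈ Finset.range (κ.rowLen 0), ((if j = (i : ℕ) then
          intCoeff E' ((κ.colLen j : ℤ) - (j : ℤ) + (k : ℤ)) else 0) +
        if j = (i : ℕ) + 1 then -u ^ (κ.colLen i - κ.colLen (i + 1) + 1) *
          intCoeff E' ((κ.colLen j : ℤ) - (j : ℤ) + (k : ℤ)) else 0) := by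
      rw [← Fin.sum_univ_eq_sum_range fun j => (if j = (i : ℕ) then
          intCoeff E' ((κ.colLen j : ℤ) - (j : ℤ) + (k : ℤ)) else 0) +
        if j = (i : ℕ) + 1 then -u ^ (κ.colLen i - κ.colLen (i + 1) + 1) *
          intCoeff E' ((κ.colLen j : ℤ) - (j : ℤ) + (k : ℤ)) else 0]
      refine Finset.sum_congr rfl fun j _ => ?_
      simp only [U, Matrix.of_apply, add_mul, ite_mul, one_mul, zero_mul]
    rw [hsum, Finset.sum_add_distrib, Finset.sum_ite_eq', Finset.sum_ite_eq',
      if_pos (Finset.mem_range.mpr i.isLt)]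
    have hlast : (if (i : ℕ) + 1 ∈ Finset.range (κ.rowLen 0) then
        -u ^ (κ.colLen i - κ.colLen (i + 1) + 1) *
          intCoeff E' ((κ.colLen (i + 1) : ℤ) - ((i + 1 : ℕ) : ℤ) + (k : ℤ)) else 0) =
        -(u ^ (κ.colLen i - κ.colLen (i + 1) + 1) *
          intCoeff E' ((κ.colLen i : ℤ) - (i : ℤ) + (k : ℤ) -
            (κ.colLen i - κ.colLen (i + 1) + 1 : ℕ))) := by
      have h3 := hanti i
      have hidx : (κ.colLen i : ℤ) - (i : ℤ) + (k : ℤ) -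
          (κ.colLen i - κ.colLen (i + 1) + 1 : ℕ) =
          (κ.colLen (i + 1) : ℤ) - ((i + 1 : ℕ) : ℤ) + (k : ℤ) := by omega
      rw [hidx]
      split_ifs with hi
      · ring
      · rw [Finset.mem_range, not_lt] at hi
        have hk := k.isLt
        rw [intCoeff_of_neg]
        · simp
        · rw [colLen_eq_zero_iff.mpr hi]
          omega
    rw [hlast, ← sub_eq_add_neg, intCoeff_geometric h]
    refine Finset.sum_congr rfl fun r _ => ?_
    congr 2
    ring

open Classical in
theorem diagramDet_one (κ : YoungDiagram) :
    diagramDet 1 κ = if κ = ⊥ then 1 else 0 := by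
  split_ifs with h
  · subst h
    have : IsEmpty (Fin ((⊥ : YoungDiagram).rowLen 0)) := by
      rw [rowLen_bot]
      infer_instance
    rw [diagramDet, jacobiTrudi, Matrix.det_isEmpty]
  · have h0 : 0 < κ.rowLen 0 := by
      by_contra h0
      refine h (ext_rowLen fun i => ?_)
      have := κ.rowLen_anti 0 i (Nat.zero_le _)
      rw [rowLen_bot]
      omega
    have h1 : κ.colLen 0 ≠ 0 := fun h1 => absurd (colLen_eq_zero_iff.mp h1) (by omega)
    rw [diagramDet, jacobiTrudi, Matrix.det_eq_zero_of_row_eq_zero ⟨0, h0⟩]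
    intro j
    rw [Matrix.of_apply]
    simp only [Nat.cast_zero, sub_zero]
    rw [← Nat.cast_add, intCoeff_natCast, PowerSeries.coeff_one, if_neg (by omega)]

theorem constantCoeff_genSeries {m : ℕ} (x : Fin m → ℝ) (t : ℝ) :
    PowerSeries.constantCoeff (genSeries x t) = 1 := by
  simp [genSeries, map_prod]

/-- The functions `S_κ(x;t)` are nonnegative and obey the branching rule of the weights of the
growth diagram. -/
theorem genSchur_nonneg_and_ofReal {m : ℕ} {x : Fin m → ℝ} (hx : ∀ i, 0 ≤ x i) {t : ℝ} (ht : t ≤ 0)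
    (κ : YoungDiagram) : 0 ≤ genSchur x t κ ∧ ENNReal.ofReal (genSchur x t κ) =
      superSchur (fun i => ENNReal.ofReal (-t * x i)) (fun i => ENNReal.ofReal (x i)) κ := by
  induction m generalizing κ with
  | zero =>
    rw [genSchur_eq_diagramDet, show genSeries x t = 1 by simp [genSeries], diagramDet_one,
      superSchur]
    split_ifs <;> simp
  | succ m ih =>
    set a := x (Fin.last m) with ha
    have ha0 : 0 ≤ a := hx _
    have ih' := ih (x := Fin.init x) fun i => hx i.castSucc
    let E₁ : PowerSeries ℝ :=
      genSeries (Fin.init x) t * (1 + PowerSeries.C (t * a) * PowerSeries.X)⁻¹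
    have hE₂ : genSeries x t = E₁ * (1 + PowerSeries.C a * PowerSeries.X) := by
      simp only [genSeries, Fin.prod_univ_castSucc, E₁, Fin.init, ha]
      ring
    have hE₁ : genSeries (Fin.init x) t =
        E₁ * (1 + PowerSeries.C (-(-t * a)) * PowerSeries.X) := by
      simp only [E₁]
      rw [show -(-t * a) = t * a by ring, mul_assoc, PowerSeries.inv_mul_cancel _ (by simp),
        mul_one]
    have h1 := diagramDet_div_linear (constantCoeff_genSeries _ t) (fun ν => (ih' ν).1)
      (mul_nonneg (neg_nonneg.mpr ht) ha0) hE₁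
    have h2 := diagramDet_mul_linear (E := E₁) (by simp [E₁, constantCoeff_genSeries])
      (fun ν => (h1 ν).1) ha0 κ
    rw [← hE₂] at h2
    refine ⟨h2.1, h2.2.trans ?_⟩
    rw [superSchur]
    refine tsum_congr fun ν => ?_
    rw [(h1 ν).2]
    congr 1
    refine tsum_congr fun μ => ?_
    congr 1
    exact (ih' μ).2

/-! ### Longest increasing subsequences -/

namespace MarkedLetter

theorem lt_iff_key {a b : MarkedLetter} : a < b ↔ key a < key b := Iff.rfl

theorem marked_lt_unmarked (k : ℕ+) : marked k < unmarked k := by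
  rw [lt_iff_key, key, key, Prod.Lex.toLex_lt_toLex]
  exact Or.inr ⟨rfl, Bool.false_lt_true⟩

theorem unmarked_lt_marked {k l : ℕ+} (h : k < l) : unmarked k < marked l := by
  rw [lt_iff_key, key, key, Prod.Lex.toLex_lt_toLex]
  exact Or.inl h

end MarkedLetter

/-- The letter `b` may follow the letter `a` in an increasing word. -/
def Precedes (a b : MarkedLetter) : Prop :=
  a ≤ b ∧ ∀ k : ℕ+, ¬ (a = .marked k ∧ b = .marked k)

theorem isIncreasing_iff_pairwise {σ : List MarkedLetter} :
    IsIncreasing σ ↔ σ.Pairwise Precedes := by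
  rw [IsIncreasing, List.pairwise_iff_forall_sublist, List.pairwise_iff_forall_sublist]
  constructor
  · rintro ⟨h1, h2⟩ a b hab
    refine ⟨h1 hab, ?_⟩
    rintro k ⟨rfl, rfl⟩
    exact h2 k hab
  · intro h
    exact ⟨fun hab => (h hab).1, fun k hk => (h hk).2 k ⟨rfl, rfl⟩⟩

theorem Precedes.of_lt {a b : MarkedLetter} (h : a < b) : Precedes a b := by
  refine ⟨h.le, ?_⟩
  rintro k ⟨rfl, rfl⟩
  exact lt_irrefl _ h

theorem Precedes.of_le_unmarked {a : MarkedLetter} {k : ℕ+} (h : a ≤ .unmarked k) :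
    Precedes a (.unmarked k) :=
  ⟨h, fun _ h' => by cases h'.2⟩

theorem Precedes.lt_of_marked {a : MarkedLetter} {k : ℕ+} (h : Precedes a (.marked k)) :
    a < .marked k :=
  lt_of_le_of_ne h.1 fun h' => h.2 k ⟨h', rfl⟩

/-- `k` is the maximal length of an increasing subsequence of the word `w`. -/
def IsLongest (w : List MarkedLetter) (k : ℕ) : Prop :=
  IsGreatest {k | ∃ σ : List MarkedLetter, σ.Sublist w ∧ IsIncreasing σ ∧ σ.length = k} k

theorem isLongest_iff {w : List MarkedLetter} {k : ℕ} : IsLongest w k ↔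
    (∃ σ : List MarkedLetter, σ.Sublist w ∧ σ.Pairwise Precedes ∧ σ.length = k) ∧
      ∀ σ : List MarkedLetter, σ.Sublist w → σ.Pairwise Precedes → σ.length ≤ k := by
  simp only [IsLongest, IsGreatest, upperBounds, Set.mem_ofPred_eq, isIncreasing_iff_pairwise]
  refine and_congr_right fun _ => ⟨fun h σ h1 h2 => h ⟨σ, h1, h2, rfl⟩, ?_⟩
  rintro h _ ⟨σ, h1, h2, rfl⟩
  exact h σ h1 h2

theorem isLongest_nil : IsLongest [] 0 := by
  rw [isLongest_iff]
  refine ⟨⟨[], List.Sublist.refl _, List.Pairwise.nil, rfl⟩, fun σ h _ => ?_⟩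
  rw [List.sublist_nil.mp h]
  rfl

/-- If all letters of `σ` are less than `a`, then `σ` survives the deletion of the letters that are
not less than `a`. -/
theorem sublist_filter_lt {σ U : List MarkedLetter} {a : MarkedLetter} (h : σ.Sublist U)
    (ha : ∀ x ∈ σ, x < a) : σ.Sublist (U.filter fun x => decide (x < a)) := by
  have := h.filter fun x => decide (x < a)
  rwa [List.filter_eq_self.mpr fun x hx => decide_eq_true (ha x hx)] at this

theorem lt_of_mem_filter_append {U R : List MarkedLetter} {a : MarkedLetter}
    (hR : ∀ x ∈ R, x < a) : ∀ x ∈ (U.filter fun x => decide (x < a)) ++ R, x < a := by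
  intro x hx
  rcases List.mem_append.mp hx with hx | hx
  · exact of_decide_eq_true (List.mem_filter.mp hx).2
  · exact hR x hx

/-- The recursion of last passage percolation for an unmarked letter. -/
theorem IsLongest.append_unmarked {U R : List MarkedLetter} {k : ℕ+} {p q c : ℕ}
    (hU : ∀ x ∈ U, x ≤ .unmarked k) (hR : ∀ x ∈ R, x < .unmarked k) (hp : IsLongest U p)
    (hq : IsLongest ((U.filter fun x => decide (x < .unmarked k)) ++ R) q) :
    IsLongest (U ++ (R ++ List.replicate c (.unmarked k))) (max q p + c) := by
  rw [isLongest_iff] at *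
  constructor
  · -- append all copies of the letter to an optimal subsequence of either kind
    have key : ∀ (V : List MarkedLetter) (v : ℕ), V.Sublist (U ++ R) →
        (∃ σ : List MarkedLetter, σ.Sublist V ∧ σ.Pairwise Precedes ∧ σ.length = v) →
        ∃ σ : List MarkedLetter, σ.Sublist (U ++ (R ++ List.replicate c (.unmarked k))) ∧
          σ.Pairwise Precedes ∧ σ.length = v + c := by
      rintro V v hV ⟨σ, h1, h2, rfl⟩
      refine ⟨σ ++ List.replicate c (.unmarked k), ?_, ?_, by simp⟩
      · rw [← List.append_assoc]
        exact (h1.trans hV).append (List.Sublist.refl _)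
      · refine List.pairwise_append.mpr ⟨h2, ?_, ?_⟩
        · exact List.pairwise_replicate.mpr (Or.inr (Precedes.of_le_unmarked le_rfl))
        · intro x hx y hy
          obtain rfl := List.eq_of_mem_replicate hy
          rcases List.mem_append.mp (hV.subset (h1.subset hx)) with h | h
          · exact Precedes.of_le_unmarked (hU x h)
          · exact Precedes.of_lt (hR x h)
    rcases max_choice q p with h | h
    · rw [h]
      exact key _ q (List.filter_sublist.append (List.Sublist.refl _)) hq.1
    · rw [h]
      exact key _ p (List.sublist_append_left _ _) hp.1
  · intro σ hσ hinc
    obtain ⟨σ₁, σ', rfl, hσ₁, hσ'⟩ := List.sublist_append_iff.mp hσ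
    obtain ⟨σ₂, σ₃, rfl, hσ₂, hσ₃⟩ := List.sublist_append_iff.mp hσ'
    have h3 : σ₃.length ≤ c := by simpa using hσ₃.length_le
    rw [← List.append_assoc] at hinc
    have h12 := (List.pairwise_append.mp hinc).1
    rw [List.length_append, List.length_append]
    rcases σ₂ with _ | ⟨x, σ₂⟩
    · have := hp.2 σ₁ hσ₁ (List.pairwise_append.mp h12).1
      simp only [List.length_nil]
      omega
    · -- a letter of `R` cannot follow the letter `k` itself
      have hlt : ∀ z ∈ σ₁, z < .unmarked k := fun z hz =>
        lt_of_le_of_lt ((List.pairwise_append.mp h12).2.2 z hz x List.mem_cons_self).1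
          (hR x (hσ₂.subset List.mem_cons_self))
      have := hq.2 _ ((sublist_filter_lt hσ₁ hlt).append hσ₂) h12
      rw [List.length_append] at this
      omega

/-- The recursion of last passage percolation for a marked letter. -/
theorem IsLongest.append_marked {U R : List MarkedLetter} {k : ℕ+} {p q c : ℕ} (hc : c ≤ 1)
    (hR : ∀ x ∈ R, x < .marked k) (hp : IsLongest U p)
    (hq : IsLongest ((U.filter fun x => decide (x < .marked k)) ++ R) q) :
    IsLongest (U ++ (R ++ List.replicate c (.marked k))) (max p (q + c)) := by
  rw [isLongest_iff] at *
  constructor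
  · rcases max_choice p (q + c) with h | h
    · rw [h]
      obtain ⟨σ, h1, h2, h3⟩ := hp.1
      exact ⟨σ, h1.trans (List.sublist_append_left _ _), h2, h3⟩
    · rw [h]
      obtain ⟨σ, h1, h2, rfl⟩ := hq.1
      refine ⟨σ ++ List.replicate c (.marked k), ?_, ?_, by simp⟩
      · rw [← List.append_assoc]
        exact (h1.trans (List.filter_sublist.append (List.Sublist.refl _))).append
          (List.Sublist.refl _)
      · refine List.pairwise_append.mpr ⟨h2, List.pairwise_replicate.mpr (Or.inl hc), ?_⟩
        intro x hx y hy
        obtain rfl := List.eq_of_mem_replicate hy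
        exact Precedes.of_lt (lt_of_mem_filter_append hR x (h1.subset hx))
  · intro σ hσ hinc
    obtain ⟨σ₁, σ', rfl, hσ₁, hσ'⟩ := List.sublist_append_iff.mp hσ
    obtain ⟨σ₂, σ₃, rfl, hσ₂, hσ₃⟩ := List.sublist_append_iff.mp hσ'
    have h3 : σ₃.length ≤ c := by simpa using hσ₃.length_le
    have hinc' := List.pairwise_append.mp hinc
    rw [← List.append_assoc] at hinc
    have h12 := (List.pairwise_append.mp hinc).1
    rw [List.length_append, List.length_append]
    by_cases hne : σ₂ = [] ∧ σ₃ = []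
    · obtain ⟨rfl, rfl⟩ := hne
      have := hp.2 σ₁ hσ₁ (List.pairwise_append.mp h12).1
      simp only [List.length_nil]
      omega
    · -- neither a letter of `R` nor a further copy of the letter `k'` can follow `k'`
      have hlt : ∀ z ∈ σ₁, z < .marked k := by
        intro z hz
        rcases σ₂ with _ | ⟨x, σ₂⟩
        · rcases σ₃ with _ | ⟨x, σ₃⟩
          · exact (hne ⟨rfl, rfl⟩).elim
          · have hx : x = .marked k := List.eq_of_mem_replicate (hσ₃.subset List.mem_cons_self)
            have := hinc'.2.2 z hz x (by simp)
            rw [hx] at this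
            exact this.lt_of_marked
        · exact lt_of_le_of_lt (hinc'.2.2 z hz x (by simp)).1
            (hR x (hσ₂.subset List.mem_cons_self))
      have := hq.2 _ ((sublist_filter_lt hσ₁ hlt).append hσ₂) h12
      rw [List.length_append] at this
      omega

/-! ### The first rows of the growth diagram -/

/-- The concatenation of the words `R 0, R 1, …`. -/
def concat {n : ℕ} (R : Fin n → List MarkedLetter) : List MarkedLetter :=
  (List.finRange n).flatMap R

theorem concat_succ {n : ℕ} (R : Fin (n + 1) → List MarkedLetter) :
    concat R = concat (Fin.init R) ++ R (Fin.last n) := by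
  rw [concat, List.finRange_succ_last, List.flatMap_append, List.flatMap_map]
  simp only [List.flatMap_cons, List.flatMap_nil, List.append_nil]
  rfl

/-- The first rows of the diagrams of the column `lam` are the lengths of the longest increasing
subsequences of the words `R 0`, `R 0 ++ R 1`, and so on. -/
def Records : {n : ℕ} → (Fin n → List MarkedLetter) → (Fin n → YoungDiagram) → Prop
  | 0, _, _ => True
  | n + 1, R, lam =>
    Records (Fin.init R) (Fin.init lam) ∧ IsLongest (concat R) ((lam (Fin.last n)).rowLen 0)

theorem Records.isLongest {n : ℕ} {R : Fin n → List MarkedLetter} {lam : Fin n → YoungDiagram}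
    (h : Records R lam) : IsLongest (concat R) ((top lam).rowLen 0) := by
  cases n with
  | zero =>
    rw [top, rowLen_bot]
    exact isLongest_nil
  | succ n => exact h.2

/-- Deleting the copies of `a` from a word composed of blocks of letters less than `a`, each
followed by copies of `a`. -/
theorem filter_concat_append_replicate {n : ℕ} {R : Fin n → List MarkedLetter} {a : MarkedLetter}
    (hR : ∀ j, ∀ x ∈ R j, x < a) (c : Fin n → ℕ) :
    ((concat fun j => R j ++ List.replicate (c j) a).filter fun x => decide (x < a)) =
      concat R := by
  rw [concat, concat, List.filter_flatMap]
  congr 1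
  funext j
  rw [List.filter_append, List.filter_eq_self.mpr fun x hx => decide_eq_true (hR j x hx),
    List.filter_eq_nil_iff.mpr, List.append_nil]
  intro x hx
  simp [List.eq_of_mem_replicate hx]

theorem le_of_mem_concat {n : ℕ} {R : Fin n → List MarkedLetter} {a : MarkedLetter}
    (hR : ∀ j, ∀ x ∈ R j, x < a) {c : Fin n → ℕ} {x : MarkedLetter}
    (hx : x ∈ concat fun j => R j ++ List.replicate (c j) a) : x ≤ a := by
  rw [concat, List.mem_flatMap] at hx
  obtain ⟨j, -, hx⟩ := hx
  rcases List.mem_append.mp hx with hx | hx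
  · exact (hR j x hx).le
  · exact (List.eq_of_mem_replicate hx).le

theorem Records.step_unmarked {n : ℕ} {R : Fin n → List MarkedLetter} {lam : Fin n → YoungDiagram}
    (h : Records R lam) {k : ℕ+} (hR : ∀ j, ∀ x ∈ R j, x < .unmarked k) (c : Fin n → ℕ) :
    Records (fun j => R j ++ List.replicate (c j) (.unmarked k)) (step hRule lam c) := by
  induction n with
  | zero => trivial
  | succ n ih =>
    have ih' := ih h.1 (fun j => hR j.castSucc) (Fin.init c)
    rw [step]
    refine ⟨by rwa [Fin.init_snoc], ?_⟩
    rw [Fin.snoc_last, rowLen_zero_hRule, concat_succ]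
    refine IsLongest.append_unmarked ?_ (hR _) ih'.isLongest ?_
    · exact fun x hx => le_of_mem_concat (fun j => hR j.castSucc) hx
    · have hfilter : ((concat (Fin.init fun j => R j ++
          List.replicate (c j) (.unmarked k))).filter fun x => decide (x < .unmarked k)) =
          concat (Fin.init R) :=
        filter_concat_append_replicate (fun j => hR (Fin.castSucc j)) (Fin.init c)
      rw [hfilter, ← concat_succ]
      exact h.2

theorem Records.step_marked {n : ℕ} {R : Fin n → List MarkedLetter} {lam : Fin n → YoungDiagram}
    (h : Records R lam) {k : ℕ+} (hR : ∀ j, ∀ x ∈ R j, x < .marked k) (c : Fin n → Bool) :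
    Records (fun j => R j ++ List.replicate (c j).toNat (.marked k))
      (step (fun lam μ ν b => vRule lam μ ν (Bool.toNat b)) lam c) := by
  induction n with
  | zero => trivial
  | succ n ih =>
    have ih' := ih h.1 (fun j => hR j.castSucc) (Fin.init c)
    rw [step]
    refine ⟨by rwa [Fin.init_snoc], ?_⟩
    rw [Fin.snoc_last, rowLen_zero_vRule, concat_succ]
    refine IsLongest.append_marked (Bool.toNat_le _) (hR _) ih'.isLongest ?_
    have hfilter : ((concat (Fin.init fun j => R j ++
        List.replicate (c j).toNat (.marked k))).filter fun x => decide (x < .marked k)) =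
        concat (Fin.init R) :=
      filter_concat_append_replicate (fun j => hR (Fin.castSucc j))
        fun j => (c (Fin.castSucc j)).toNat
    rw [hfilter, ← concat_succ]
    exact h.2

/-- The word contributed by a column of a matrix, in which `(b, k)` stands for `b` marked and `k`
unmarked letters. -/
def columnWord {m n : ℕ} (A : Fin m → Fin n → Bool × ℕ) (j : Fin n) : List MarkedLetter :=
  (List.finRange m).flatMap fun i =>
    List.replicate (A i j).1.toNat (.marked (i : ℕ).succPNat) ++
      List.replicate (A i j).2 (.unmarked (i : ℕ).succPNat)

theorem columnWord_succ {m n : ℕ} (A : Fin (m + 1) → Fin n → Bool × ℕ) (j : Fin n) :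
    columnWord A j = columnWord (Fin.init A) j ++
      List.replicate (A (Fin.last m) j).1.toNat (.marked m.succPNat) ++
        List.replicate (A (Fin.last m) j).2 (.unmarked m.succPNat) := by
  rw [columnWord, List.finRange_succ_last, List.flatMap_append, List.flatMap_map]
  simp only [List.flatMap_cons, List.flatMap_nil, List.append_nil, List.append_assoc]
  rfl

theorem lt_of_mem_columnWord {m n : ℕ} {A : Fin m → Fin n → Bool × ℕ} {j : Fin n}
    {x : MarkedLetter} (hx : x ∈ columnWord A j) : x < .marked m.succPNat := by
  rw [columnWord, List.mem_flatMap] at hx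
  obtain ⟨i, -, hx⟩ := hx
  have hi : (i : ℕ).succPNat < m.succPNat := Nat.succPNat_lt_succPNat.mpr i.isLt
  rcases List.mem_append.mp hx with hx | hx
  · rw [List.eq_of_mem_replicate hx]
    exact (MarkedLetter.marked_lt_unmarked _).trans (MarkedLetter.unmarked_lt_marked hi)
  · rw [List.eq_of_mem_replicate hx]
    exact MarkedLetter.unmarked_lt_marked hi

theorem records_lastColumn {m n : ℕ} (A : Fin m → Fin n → Bool × ℕ) :
    Records (columnWord A) (lastColumn A) := by
  induction m with
  | zero =>
    induction n with
    | zero => trivial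
    | succ n ih =>
      refine ⟨ih fun i => i.elim0, ?_⟩
      have h : concat (columnWord A) = [] := by simp [concat, columnWord]
      rw [h, lastColumn, rowLen_bot]
      exact isLongest_nil
  | succ m ih =>
    have h1 := (ih (Fin.init A)).step_marked (k := m.succPNat)
      (fun j x hx => lt_of_mem_columnWord hx) fun j => (A (Fin.last m) j).1
    have h2 := h1.step_unmarked (k := m.succPNat) (fun j x hx => by
      rcases List.mem_append.mp hx with hx | hx
      · exact (lt_of_mem_columnWord hx).trans (MarkedLetter.marked_lt_unmarked _)
      · rw [List.eq_of_mem_replicate hx]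
        exact MarkedLetter.marked_lt_unmarked _) fun j => (A (Fin.last m) j).2
    rw [funext fun j => columnWord_succ A j]
    exact h2

/-! ### Matrix entries as pairs of multiplicities -/

/-- An entry as a pair `(b, k)`: the number `b ≤ 1` of marked letters and the number `k` of
unmarked letters that it contributes to the biword. -/
def entryEquiv : Bool × ℕ ≃ PEntry where
  toFun
    | (false, 0) => .zero
    | (false, k + 1) => .letter (.unmarked k.succPNat)
    | (true, k) => .letter (.marked k.succPNat)
  invFun
    | .zero => (false, 0)
    | .letter (.unmarked k) => (false, k)
    | .letter (.marked k) => (true, k.natPred)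
  left_inv := by
    rintro ⟨_ | _, _ | k⟩ <;> rfl
  right_inv := by
    rintro (_ | (k | k))
    · rfl
    · simp
    · obtain ⟨k, rfl⟩ : ∃ l : ℕ, k = l.succPNat := ⟨k.natPred, by simp⟩
      rfl

/-- Matrices of multiplicities as matrices in the marked alphabet. -/
def matrixEquiv (m n : ℕ) : (Fin m → Fin n → Bool × ℕ) ≃ PMatrix m n :=
  Equiv.piCongrRight fun _ => Equiv.piCongrRight fun _ => entryEquiv

theorem matrixEquiv_apply {m n : ℕ} (A : Fin m → Fin n → Bool × ℕ) (i : Fin m) (j : Fin n) :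
    matrixEquiv m n A i j = entryEquiv (A i j) := rfl

theorem entryWord_entryEquiv (a : ℕ+) (p : Bool × ℕ) :
    entryWord a (entryEquiv p) =
      List.replicate p.1.toNat (.marked a) ++ List.replicate p.2 (.unmarked a) := by
  obtain ⟨_ | _, _ | k⟩ := p <;> rfl

theorem entryProb_entryEquiv (t q : ℝ) (p : Bool × ℕ) :
    entryProb t q (entryEquiv p) =
      (1 - q) / (1 - t * q) * ((-t * q) ^ p.1.toNat * q ^ p.2) := by
  obtain ⟨_ | _, _ | k⟩ := p
  · simp [entryEquiv, entryProb]
  · simp [entryEquiv, entryProb]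
  all_goals
    simp only [entryEquiv, entryProb, Equiv.coe_fn_mk, Nat.succPNat_coe, Bool.toNat_true,
      Nat.succ_eq_add_one, pow_succ]
    ring

theorem ell_transpose_matrixEquiv {m n : ℕ} (A : Fin m → Fin n → Bool × ℕ) :
    ell (matrixEquiv m n A).transpose = (top (lastColumn A)).rowLen 0 := by
  have h1 := longestIncreasing_isGreatest (biword (matrixEquiv m n A).transpose)
  have h2 : (biword (matrixEquiv m n A).transpose).map Prod.snd = concat (columnWord A) := by
    simp only [biword, concat, List.map_flatMap, List.map_map]
    congr 1
    funext j
    rw [columnWord]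
    congr 1
    funext i
    rw [← entryWord_entryEquiv]
    exact List.map_id _
  rw [h2] at h1
  exact h1.unique (records_lastColumn A).isLongest

/-! ### The probability of a set of matrices -/

instance : MeasurableSingletonClass PEntry := ⟨fun _ => MeasurableSpace.measurableSet_top⟩

instance : Countable PEntry := entryEquiv.symm.injective.countable

theorem ofReal_entryProb {t a b : ℝ} (ht : t ≤ 0) (ha : 0 ≤ a) (hb : 0 ≤ b) (hab : a * b < 1)
    (p : Bool × ℕ) : ENNReal.ofReal (entryProb t (a * b) (entryEquiv p)) =
      ENNReal.ofReal ((1 - a * b) / (1 - t * (a * b))) *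
        ((ENNReal.ofReal (-t * a) * ENNReal.ofReal b) ^ p.1.toNat *
          (ENNReal.ofReal a * ENNReal.ofReal b) ^ p.2) := by
  have hq : 0 ≤ a * b := mul_nonneg ha hb
  have htq : 0 ≤ -t * (a * b) := mul_nonneg (neg_nonneg.mpr ht) hq
  have hC : 0 ≤ (1 - a * b) / (1 - t * (a * b)) :=
    div_nonneg (by linarith) (by linarith [neg_mul t (a * b)])
  rw [entryProb_entryEquiv, ENNReal.ofReal_mul hC, ENNReal.ofReal_mul (pow_nonneg htq _),
    ENNReal.ofReal_pow htq, ENNReal.ofReal_pow hq, ← ENNReal.ofReal_mul ha,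
    ← ENNReal.ofReal_mul (mul_nonneg (neg_nonneg.mpr ht) ha), mul_assoc (-t)]

theorem isProbabilityMeasure_entryMeasure {t q : ℝ} (ht : t ≤ 0) (hq : 0 ≤ q) (hq1 : q < 1) :
    IsProbabilityMeasure (entryMeasure t q) := by
  refine ⟨?_⟩
  have htq : 0 ≤ -t * q := mul_nonneg (neg_nonneg.mpr ht) hq
  have hD : 0 < 1 - t * q := by linarith [neg_mul t q]
  have hC : 0 ≤ (1 - q) / (1 - t * q) := div_nonneg (by linarith) hD.le
  have hgeom : ∑' k : ℕ, ENNReal.ofReal (q ^ k) = ENNReal.ofReal (1 - q)⁻¹ := by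
    rw [← ENNReal.ofReal_tsum_of_nonneg (fun k => pow_nonneg hq k)
      (summable_geometric_of_lt_one hq hq1), tsum_geometric_of_lt_one hq hq1]
  rw [entryMeasure, Measure.sum_apply _ MeasurableSet.univ]
  simp only [Measure.smul_apply, measure_univ, smul_eq_mul, mul_one]
  rw [← entryEquiv.tsum_eq, ENNReal.tsum_prod']
  simp only [entryProb_entryEquiv, ENNReal.ofReal_mul hC,
    ENNReal.ofReal_mul (pow_nonneg htq _), ENNReal.tsum_mul_left, hgeom]
  rw [tsum_bool]
  simp only [Bool.toNat_false, Bool.toNat_true, pow_zero, pow_one]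
  have h1q : 0 ≤ (1 - q)⁻¹ := inv_nonneg.mpr (by linarith)
  rw [← ENNReal.ofReal_mul zero_le_one, ← ENNReal.ofReal_mul htq,
    ← ENNReal.ofReal_add (by positivity) (by positivity), ← ENNReal.ofReal_mul hC]
  have hq1' : 1 - q ≠ 0 := by linarith
  have hD' : 1 - t * q ≠ 0 := hD.ne'
  rw [show (1 - q) / (1 - t * q) * (1 * (1 - q)⁻¹ + -t * q * (1 - q)⁻¹) =
      (1 - q) * (1 - q)⁻¹ * ((1 - t * q) / (1 - t * q)) by ring, mul_inv_cancel₀ hq1',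
    div_self hD', one_mul]
  exact ENNReal.ofReal_one

section Measure

variable {m n : ℕ} {x : Fin m → ℝ} {y : Fin n → ℝ} {t : ℝ}

theorem isProbabilityMeasure_matrixMeasure (hx : ∀ i, 0 ≤ x i) (hy : ∀ j, 0 ≤ y j)
    (hxy : ∀ i j, x i * y j < 1) (ht : t ≤ 0) : IsProbabilityMeasure (matrixMeasure x y t) := by
  have : ∀ i j, IsProbabilityMeasure (entryMeasure t (x i * y j)) := fun i j =>
    isProbabilityMeasure_entryMeasure ht (mul_nonneg (hx i) (hy j)) (hxy i j)
  rw [matrixMeasure]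
  infer_instance

theorem matrixMeasure_apply (hx : ∀ i, 0 ≤ x i) (hy : ∀ j, 0 ≤ y j)
    (hxy : ∀ i j, x i * y j < 1) (ht : t ≤ 0) (s : Set (PMatrix m n)) :
    matrixMeasure x y t s = ∑' A, s.indicator
      (fun A => ∏ i, ∏ j, ENNReal.ofReal (entryProb t (x i * y j) (A i j))) A := by
  have : ∀ i j, IsProbabilityMeasure (entryMeasure t (x i * y j)) := fun i j =>
    isProbabilityMeasure_entryMeasure ht (mul_nonneg (hx i) (hy j)) (hxy i j)
  rw [← Measure.tsum_indicator_apply_singleton _ s (Set.to_countable s).measurableSet]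
  have h : (fun A => matrixMeasure x y t {A}) =
      fun A => ∏ i, ∏ j, ENNReal.ofReal (entryProb t (x i * y j) (A i j)) := by
    funext A
    rw [matrixMeasure, Measure.pi_singleton]
    refine Finset.prod_congr rfl fun i _ => ?_
    rw [Measure.pi_singleton]
    refine Finset.prod_congr rfl fun j _ => ?_
    rw [entryMeasure, Measure.sum_smul_dirac_singleton]
  rw [h]

theorem matrixMeasure_transpose (hx : ∀ i, 0 ≤ x i) (hy : ∀ j, 0 ≤ y j)
    (hxy : ∀ i j, x i * y j < 1) (ht : t ≤ 0) (s : Set (PMatrix n m)) :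
    matrixMeasure x y t {A | A.transpose ∈ s} = matrixMeasure y x t s := by
  rw [matrixMeasure_apply hx hy hxy ht,
    matrixMeasure_apply hy hx (fun j i => mul_comm (x i) (y j) ▸ hxy i j) ht,
    ← (Equiv.piComm fun (_ : Fin m) (_ : Fin n) => PEntry).tsum_eq]
  refine tsum_congr fun A => ?_
  classical
  have h : (Equiv.piComm fun (_ : Fin m) (_ : Fin n) => PEntry) A = PMatrix.transpose A := rfl
  rw [h, Set.indicator_apply, Set.indicator_apply]
  refine if_congr Iff.rfl ?_ rfl
  rw [Finset.prod_comm]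
  simp only [PMatrix.transpose, mul_comm (x _)]

/-- Up to the product of the probabilities of zero entries, the law of `ℓ` for the column reading
is that of the first row under the weights `S_κ(x;t) s_κ(y)`. -/
theorem matrixMeasure_ell_transpose (hx : ∀ i, 0 ≤ x i) (hy : ∀ j, 0 ≤ y j)
    (hxy : ∀ i j, x i * y j < 1) (ht : t ≤ 0) (L : Set ℕ) :
    matrixMeasure x y t {A | ell A.transpose ∈ L} =
      ENNReal.ofReal (∏ i, ∏ j, (1 - x i * y j) / (1 - t * (x i * y j))) *
        ∑' κ : YoungDiagram, {κ : YoungDiagram | κ.rowLen 0 ∈ L}.indicator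
          (fun κ => ENNReal.ofReal (genSchur x t κ * schur y κ)) κ := by
  classical
  have hC : ∀ i j, 0 ≤ (1 - x i * y j) / (1 - t * (x i * y j)) := fun i j =>
    div_nonneg (by linarith [hxy i j]) (by
      have := mul_nonneg (neg_nonneg.mpr ht) (mul_nonneg (hx i) (hy j))
      linarith [neg_mul t (x i * y j)])
  have h1 := tsum_matrixWeight_top (fun i => ENNReal.ofReal (-t * x i))
    (fun i => ENNReal.ofReal (x i)) (fun j => ENNReal.ofReal (y j))
    fun κ => if κ.rowLen 0 ∈ L then 1 else 0
  have h2 : ∀ κ, {κ : YoungDiagram | κ.rowLen 0 ∈ L}.indicator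
      (fun κ => ENNReal.ofReal (genSchur x t κ * schur y κ)) κ =
      superSchur (fun i => ENNReal.ofReal (-t * x i)) (fun i => ENNReal.ofReal (x i)) κ *
        chainSchur (fun j => ENNReal.ofReal (y j)) κ * if κ.rowLen 0 ∈ L then 1 else 0 := by
    intro κ
    obtain ⟨h3, h4⟩ := genSchur_nonneg_and_ofReal hx ht κ
    rw [← h4, ← ofReal_schur hy, ← ENNReal.ofReal_mul h3, Set.indicator_apply]
    simp only [Set.mem_ofPred_eq, mul_ite, mul_one, mul_zero]
  simp only [h2]
  rw [← h1, matrixMeasure_apply hx hy hxy ht, ← (matrixEquiv m n).tsum_eq,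
    ← ENNReal.tsum_mul_left]
  refine tsum_congr fun A => ?_
  rw [Set.indicator_apply]
  simp only [mul_ite, mul_one, mul_zero]
  refine if_congr (by rw [Set.mem_ofPred_eq, ell_transpose_matrixEquiv]) ?_ rfl
  rw [ENNReal.ofReal_prod_of_nonneg fun i _ => Finset.prod_nonneg fun j _ => hC i j, matrixWeight,
    ← Finset.prod_mul_distrib]
  refine Finset.prod_congr rfl fun i _ => ?_
  rw [ENNReal.ofReal_prod_of_nonneg fun j _ => hC i j, ← Finset.prod_mul_distrib]
  refine Finset.prod_congr rfl fun j _ => ?_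
  rw [matrixEquiv_apply, ofReal_entryProb ht (hx i) (hy j) (hxy i j)]

theorem genSchur_mul_schur_nonneg (hx : ∀ i, 0 ≤ x i) (hy : ∀ j, 0 ≤ y j) (ht : t ≤ 0)
    (κ : YoungDiagram) : 0 ≤ genSchur x t κ * schur y κ :=
  mul_nonneg (genSchur_nonneg_and_ofReal hx ht κ).1 (schur_nonneg hy κ)

/-- The total mass of the measure on matrices yields the Cauchy identity. -/
theorem hasSum_genSchur_mul_schur (hx : ∀ i, 0 ≤ x i) (hy : ∀ j, 0 ≤ y j)
    (hxy : ∀ i j, x i * y j < 1) (ht : t ≤ 0) :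
    HasSum (fun κ : YoungDiagram => genSchur x t κ * schur y κ)
      (∏ i, ∏ j, (1 - t * (x i * y j)) / (1 - x i * y j)) := by
  have hprob := isProbabilityMeasure_matrixMeasure hx hy hxy ht
  have hD : ∀ i j, 0 < (1 - t * (x i * y j)) / (1 - x i * y j) := fun i j =>
    div_pos (by
      have := mul_nonneg (neg_nonneg.mpr ht) (mul_nonneg (hx i) (hy j))
      linarith [neg_mul t (x i * y j)]) (by linarith [hxy i j])
  have hP : 0 < ∏ i, ∏ j, (1 - t * (x i * y j)) / (1 - x i * y j) :=
    Finset.prod_pos fun i _ => Finset.prod_pos fun j _ => hD i j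
  have hinv : ∏ i, ∏ j, (1 - x i * y j) / (1 - t * (x i * y j)) =
      (∏ i, ∏ j, (1 - t * (x i * y j)) / (1 - x i * y j))⁻¹ := by
    simp only [← Finset.prod_inv_distrib, inv_div]
  have h := matrixMeasure_ell_transpose hx hy hxy ht Set.univ
  simp only [Set.mem_univ, Set.ofPred_true, measure_univ, Set.indicator_univ, hinv] at h
  rw [ENNReal.ofReal_inv_of_pos hP] at h
  have hP' : ENNReal.ofReal (∏ i, ∏ j, (1 - t * (x i * y j)) / (1 - x i * y j)) ≠ 0 :=
    (ENNReal.ofReal_pos.mpr hP).ne'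
  have hsum : ∑' κ : YoungDiagram, ENNReal.ofReal (genSchur x t κ * schur y κ) =
      ENNReal.ofReal (∏ i, ∏ j, (1 - t * (x i * y j)) / (1 - x i * y j)) := by
    rw [← one_mul (∑' κ : YoungDiagram, _), ← ENNReal.mul_inv_cancel hP' ENNReal.ofReal_ne_top,
      mul_assoc, ← h, mul_one]
  have hs := ENNReal.hasSum_toReal (hsum ▸ ENNReal.ofReal_ne_top)
  rw [← ENNReal.tsum_toReal_eq fun _ => ENNReal.ofReal_ne_top, hsum,
    ENNReal.toReal_ofReal hP.le] at hs
  simpa only [ENNReal.toReal_ofReal (genSchur_mul_schur_nonneg hx hy ht _)] using hs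

theorem Z_eq (hx : ∀ i, 0 ≤ x i) (hy : ∀ j, 0 ≤ y j) (hxy : ∀ i j, x i * y j < 1) (ht : t ≤ 0) :
    Z x y t = ∏ i, ∏ j, (1 - t * (x i * y j)) / (1 - x i * y j) :=
  (hasSum_genSchur_mul_schur hx hy hxy ht).tsum_eq

theorem Z_pos (hx : ∀ i, 0 ≤ x i) (hy : ∀ j, 0 ≤ y j) (hxy : ∀ i j, x i * y j < 1) (ht : t ≤ 0) :
    0 < Z x y t := by
  rw [Z_eq hx hy hxy ht]
  refine Finset.prod_pos fun i _ => Finset.prod_pos fun j _ => div_pos ?_ (by linarith [hxy i j])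
  have := mul_nonneg (neg_nonneg.mpr ht) (mul_nonneg (hx i) (hy j))
  linarith [neg_mul t (x i * y j)]

theorem tSchurMeasure_apply (hx : ∀ i, 0 ≤ x i) (hy : ∀ j, 0 ≤ y j) (hxy : ∀ i j, x i * y j < 1)
    (ht : t ≤ 0) (s : Set YoungDiagram) :
    tSchurMeasure x y t s = ENNReal.ofReal (1 / Z x y t) *
      ∑' κ, s.indicator (fun κ => ENNReal.ofReal (genSchur x t κ * schur y κ)) κ := by
  have hs : MeasurableSet s := MeasurableSpace.measurableSet_top
  rw [tSchurMeasure, Measure.sum_apply _ hs, ← ENNReal.tsum_mul_left]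
  refine tsum_congr fun κ => ?_
  rw [Measure.smul_apply, Measure.dirac_apply' _ hs, smul_eq_mul,
    ENNReal.ofReal_mul (one_div_pos.mpr (Z_pos hx hy hxy ht)).le]
  by_cases h : κ ∈ s <;> simp [h]

theorem matrixMeasure_eq_tSchurMeasure (hx : ∀ i, 0 ≤ x i) (hy : ∀ j, 0 ≤ y j)
    (hxy : ∀ i j, x i * y j < 1) (ht : t ≤ 0) (L : Set ℕ) :
    matrixMeasure x y t {A | ell A.transpose ∈ L} =
      tSchurMeasure x y t {κ | κ.rowLen 0 ∈ L} := by
  rw [matrixMeasure_ell_transpose hx hy hxy ht, tSchurMeasure_apply hx hy hxy ht,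
    Z_eq hx hy hxy ht]
  simp only [one_div, ← Finset.prod_inv_distrib, inv_div]

theorem isProbabilityMeasure_tSchurMeasure (hx : ∀ i, 0 ≤ x i) (hy : ∀ j, 0 ≤ y j)
    (hxy : ∀ i j, x i * y j < 1) (ht : t ≤ 0) : IsProbabilityMeasure (tSchurMeasure x y t) := by
  have hprob := isProbabilityMeasure_matrixMeasure hx hy hxy ht
  have h := matrixMeasure_eq_tSchurMeasure hx hy hxy ht Set.univ
  simp only [Set.mem_univ, Set.ofPred_true, measure_univ] at h
  exact ⟨h.symm⟩

theorem tSchurMeasure_real (hx : ∀ i, 0 ≤ x i) (hy : ∀ j, 0 ≤ y j) (hxy : ∀ i j, x i * y j < 1)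
    (ht : t ≤ 0) (s : Set YoungDiagram) :
    (tSchurMeasure x y t).real s =
      1 / Z x y t * ∑' κ : s, genSchur x t κ.1 * schur y κ.1 := by
  have hnn := genSchur_mul_schur_nonneg hx hy ht
  rw [measureReal_def, tSchurMeasure_apply hx hy hxy ht, ENNReal.toReal_mul,
    ENNReal.toReal_ofReal (one_div_pos.mpr (Z_pos hx hy hxy ht)).le, ← tsum_subtype,
    ENNReal.tsum_toReal_eq fun _ => ENNReal.ofReal_ne_top]
  simp only [ENNReal.toReal_ofReal (hnn _)]

theorem matrixMeasure_real_ell_transpose (hx : ∀ i, 0 ≤ x i) (hy : ∀ j, 0 ≤ y j)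
    (hxy : ∀ i j, x i * y j < 1) (ht : t ≤ 0) (h : ℕ) :
    (matrixMeasure x y t).real {A | ell A.transpose ≤ h} =
      (tSchurMeasure x y t).real {μ | μ.rowLen 0 ≤ h} :=
  congrArg ENNReal.toReal (matrixMeasure_eq_tSchurMeasure hx hy hxy ht (Set.Iic h))

end Measure

end TSchur

theorem mainTheorem5 (m n : ℕ) (x : Fin m → ℝ) (y : Fin n → ℝ) (t : ℝ)
    (hx : ∀ i, 0 ≤ x i) (hy : ∀ j, 0 ≤ y j) (hxy : ∀ i j, x i * y j < 1) (ht : t ≤ 0) :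
    -- the measures on matrices and on partitions are probability measures
    IsProbabilityMeasure (TSchur.matrixMeasure x y t) ∧
    (∀ μ : YoungDiagram, 0 ≤ TSchur.genSchur x t μ * TSchur.schur y μ) ∧
    HasSum (fun μ : YoungDiagram => TSchur.genSchur x t μ * TSchur.schur y μ)
      (∏ i, ∏ j, (1 - t * (x i * y j)) / (1 - x i * y j)) ∧
    IsProbabilityMeasure (TSchur.tSchurMeasure x y t) ∧
    ∀ h : ℕ,
      -- the biword of the matrix read column by column
      ((TSchur.matrixMeasure x y t).real {A | TSchur.ell A.transpose ≤ h} =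
          1 / TSchur.Z x y t * ∑' μ : {μ : YoungDiagram // μ.rowLen 0 ≤ h},
            TSchur.genSchur x t μ.1 * TSchur.schur y μ.1 ∧
        (TSchur.matrixMeasure x y t).real {A | TSchur.ell A.transpose ≤ h} =
          (TSchur.tSchurMeasure x y t).real {μ | μ.rowLen 0 ≤ h}) ∧
      -- the biword of the matrix read row by row: the variables change roles
      ((TSchur.matrixMeasure x y t).real {A | TSchur.ell A ≤ h} =
          1 / TSchur.Z y x t * ∑' μ : {μ : YoungDiagram // μ.rowLen 0 ≤ h},
            TSchur.genSchur y t μ.1 * TSchur.schur x μ.1 ∧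
        (TSchur.matrixMeasure x y t).real {A | TSchur.ell A ≤ h} =
          (TSchur.tSchurMeasure y x t).real {μ | μ.rowLen 0 ≤ h}) := by
  have hyx : ∀ j i, y j * x i < 1 := fun j i => mul_comm (x i) (y j) ▸ hxy i j
  refine ⟨TSchur.isProbabilityMeasure_matrixMeasure hx hy hxy ht,
    TSchur.genSchur_mul_schur_nonneg hx hy ht, TSchur.hasSum_genSchur_mul_schur hx hy hxy ht,
    TSchur.isProbabilityMeasure_tSchurMeasure hx hy hxy ht, fun h => ?_⟩
  have h1 := TSchur.matrixMeasure_real_ell_transpose hx hy hxy ht h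
  -- the row reading of `A` is the column reading of its transpose, whose law has `x`, `y` exchanged
  have h2 : (TSchur.matrixMeasure x y t).real {A | TSchur.ell A ≤ h} =
      (TSchur.tSchurMeasure y x t).real {μ | μ.rowLen 0 ≤ h} := by
    rw [← TSchur.matrixMeasure_real_ell_transpose hy hx hyx ht h]
    exact congrArg ENNReal.toReal
      (TSchur.matrixMeasure_transpose hx hy hxy ht {A | TSchur.ell A.transpose ≤ h})
  exact ⟨⟨h1.trans (TSchur.tSchurMeasure_real hx hy hxy ht _), h1⟩,
    h2.trans (TSchur.tSchurMeasure_real hy hx hyx ht _), h2⟩
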